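/- \textbf{Theorem (classification of all $C^\infty$ Koopman eigenfunctions for a point attractor).} Let $Q$ be a smooth ($C^\infty$) manifold of dimension $n$, let $\mathbb{T}=\mathbb{Z}$ or $\mathbb{T}=\mathbb{R}$, and let $\Phi\colon Q\times\mathbb{T}\to Q$, $(x,t)\mapsto\Phi^t(x)$, be a $C^\infty$ dynamical system, i.e. a $C^\infty$ map with $\Phi^0=\mathrm{id}_Q$ and $\Phi^{s+t}=\Phi^s\circ\Phi^t$ for all $s,t\in\mathbb{T}$. Let $x_0\in Q$ be a globally attracting hyperbolic fixed point of $\Phi$: $\Phi^t(x_0)=x_0$ for all $t$; $x_0$ is globally asymptotically stable (every neighbourhood $U$ of $x_0$ contains $\Phi^t(V)$ for all $t\ge 0$, for some neighbourhood $V$ of $x_0$, and $\Phi^t(x)\to x_0$ as $t\to+\infty$ for every $x\in Q$); and no eigenvalue of the complexification of $\mathsf{D}_{x_0}\Phi^1\colon \mathsf{T}_{x_0}Q\to\mathsf{T}_{x_0}Q$ has modulus $1$. Assume that $\mathsf{D}_{x_0}\Phi^1$ is semisimple (diagonalizable over $\mathbb{C}$) and that $(\mathsf{D}_{x_0}\Phi^1,\mathsf{D}_{x_0}\Phi^1)$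 is $\infty$-nonresonant: if $\lambda_1,\dots,\lambda_n\in\mathbb{C}$ are the eigenvalues of $\mathsf{D}_{x_0}\Phi^1$ repeated with multiplicity, then $\lambda_j\neq\lambda_1^{m_1}\cdots\lambda_n^{m_n}$ for every $j\in\{1,\dots,n\}$ and every $m\in\mathbb{N}_{\ge 0}^n$ with $m_1+\cdots+m_n\ge 2$. A function $\varphi\colon Q\to\mathbb{C}$ is called a Koopman eigenfunction if it is not identically zero and there is $\mu\in\mathbb{C}$ with $\varphi\circ\Phi^t=e^{\mu t}\varphi$ for all $t\in\mathbb{T}$; a $C^1$ Koopman eigenfunction $\psi$ is called principal if $\psi(x_0)=0$ and $\mathsf{D}_{x_0}\psi\neq 0$. Then there exists an $n$-tuple $\psi=(\psi_1,\dots,\psi_n)$ of $C^\infty$ principal eigenfunctions such that every $C^\infty$ Koopman eigenfunction $\varphi$ is a finite sum $$\varphi=\sum_{|i|+|\ell|\le k}c_{i,\ell}\,\psi^{[i]}\,\bar\psi^{[\ell]}$$ for some $k\in\mathbb{N}_{\ge 1}$ and some coefficients $c_{i,\ell}\in\mathbb{C}$, where $i,\ell\in\mathbb{N}_{\ge 0}^n$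 are multi-indices, $|i|=i_1+\cdots+i_n$, $\psi^{[i]}=\psi_1^{i_1}\cdots\psi_n^{i_n}$ and $\bar\psi=(\bar\psi_1,\dots,\bar\psi_n)$ is the componentwise complex conjugate. -/

import Mathlib

open Set Filter Topology Manifold
open scoped ContDiff

noncomputable section

/-- `(X, Y)` is `k`-nonresonant: if `lam` lists the eigenvalues of `Y` repeated with (algebraic)
multiplicity, then no eigenvalue of `X` equals a product `∏ j, lam j ^ m j` with
`2 ≤ m₁ + ⋯ + m_d ≤ k`. -/
def IsNonresonant {V W : Type*} [AddCommGroup V] [Module ℂ V] [AddCommGroup W] [Module ℂ W]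
    [Module.Free ℂ W] [Module.Finite ℂ W]
    (k : ℕ) (X : Module.End ℂ V) (Y : Module.End ℂ W) : Prop :=
  ∀ lam : Fin (Module.finrank ℂ W) → ℂ,
    Multiset.map lam Finset.univ.val = (LinearMap.charpoly Y).roots →
    ∀ μ : ℂ, X.HasEigenvalue μ →
      ∀ m : Fin (Module.finrank ℂ W) → ℕ, 2 ≤ ∑ j, m j → ∑ j, m j ≤ k →
        μ ≠ ∏ j, lam j ^ m j

/-- `(X, Y)` is `∞`-nonresonant: it is `k`-nonresonant for every `k ≥ 1`. -/
def IsInftyNonresonant {V W : Type*} [AddCommGroup V] [Module ℂ V] [AddCommGroup W] [Module ℂ W]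
    [Module.Free ℂ W] [Module.Finite ℂ W]
    (X : Module.End ℂ V) (Y : Module.End ℂ W) : Prop :=
  ∀ k : ℕ, 1 ≤ k → IsNonresonant k X Y

section Dynamics

variable {n : ℕ} {Q : Type*} [TopologicalSpace Q] [ChartedSpace (EuclideanSpace ℝ (Fin n)) Q]

/-- The derivative of `f : Q → Q` at a fixed point `x` of `f`, as an endomorphism of the tangent
space at `x` (which Mathlib identifies with the model space by means of the preferred chart at
`x = f x`). -/
def derivAtFixed (f : Q → Q) (x : Q) : Module.End ℝ (EuclideanSpace ℝ (Fin n)) where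
  toFun v := mfderiv (𝓡 n) (𝓡 n) f x v
  map_add' v w := (mfderiv (𝓡 n) (𝓡 n) f x).map_add v w
  map_smul' c v := (mfderiv (𝓡 n) (𝓡 n) f x).map_smul c v

/-- The complexification of a real linear endomorphism. -/
def complexify (L : Module.End ℝ (EuclideanSpace ℝ (Fin n))) :
    Module.End ℂ (TensorProduct ℝ ℂ (EuclideanSpace ℝ (Fin n))) :=
  LinearMap.baseChange ℂ L

variable {𝕋 : Type*} [TopologicalSpace 𝕋] [CommRing 𝕋] [PartialOrder 𝕋] [Algebra 𝕋 ℝ]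

/-- `x₀` is a fixed point of `Φ` that is globally asymptotically stable (it is stable, and every
forward orbit converges to it) and hyperbolic (no eigenvalue of the complexified derivative of the
time-one map at `x₀` lies on the unit circle). Used for `𝕋 = ℤ` and `𝕋 = ℝ`. -/
structure IsGloballyAttractingHyperbolicFixedPoint (Φ : Flow 𝕋 Q) (x₀ : Q) : Prop where
  fixed : ∀ t : 𝕋, Φ t x₀ = x₀
  stable : ∀ U ∈ 𝓝 x₀, ∃ V ∈ 𝓝 x₀, ∀ x ∈ V, ∀ t : 𝕋, 0 ≤ t → Φ t x ∈ U
  attracting : ∀ x : Q, Tendsto (fun t : 𝕋 => Φ t x) atTop (𝓝 x₀)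
  hyperbolic : ∀ z : ℂ, (complexify (derivAtFixed (n := n) (Φ 1) x₀)).HasEigenvalue z → ‖z‖ ≠ 1

/-- `ψ` is a Koopman eigenfunction of `Φ`: it is not identically zero and, for some `μ ∈ ℂ`,
`ψ ∘ Φ^t = e^{μ t} ψ` for all times `t`. -/
def IsKoopmanEigenfunction {Q : Type*} [TopologicalSpace Q] (Φ : Flow 𝕋 Q) (ψ : Q → ℂ) : Prop :=
  (∃ x, ψ x ≠ 0) ∧
    ∃ μ : ℂ, ∀ t : 𝕋, ∀ x : Q, ψ (Φ t x) = Complex.exp (μ * ((algebraMap 𝕋 ℝ t : ℝ) : ℂ)) * ψ x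

/-- `ψ` is a principal eigenfunction of `Φ` with respect to the (closed, invariant) set `M`: it is
a `C¹` Koopman eigenfunction that vanishes on `M` and whose derivative is nonzero at every point
of `M`. -/
structure IsPrincipalEigenfunction (Φ : Flow 𝕋 Q) (M : Set Q) (ψ : Q → ℂ) : Prop where
  eigenfunction : IsKoopmanEigenfunction Φ ψ
  contMDiff : ContMDiff (𝓡 n) 𝓘(ℝ, ℂ) 1 ψ
  vanishes : ∀ x ∈ M, ψ x = 0
  deriv_ne_zero : ∀ x ∈ M, mfderiv (𝓡 n) 𝓘(ℝ, ℂ) ψ x ≠ 0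

end Dynamics

/-- The pairs `(i, l)` of `n`-dimensional multi-indices with `|i| + |l| ≤ k`. -/
def multiIndexPairs (n k : ℕ) : Finset ((Fin n → ℕ) × (Fin n → ℕ)) :=
  ((Fintype.piFinset fun _ => Finset.range (k + 1)) ×ˢ
    (Fintype.piFinset fun _ => Finset.range (k + 1))).filter
      fun p => ∑ j, p.1 j + ∑ j, p.2 j ≤ k

theorem mem_multiIndexPairs {n k : ℕ} {p : (Fin n → ℕ) × (Fin n → ℕ)} :
    p ∈ multiIndexPairs n k ↔ ∑ j, p.1 j + ∑ j, p.2 j ≤ k := by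
  simp only [multiIndexPairs, Finset.mem_filter, Finset.mem_product, Fintype.mem_piFinset,
    Finset.mem_range, and_iff_right_iff_imp]
  intro h
  refine ⟨fun a => ?_, fun a => ?_⟩
  · have := Finset.single_le_sum (f := p.1) (fun i _ => Nat.zero_le _) (Finset.mem_univ a)
    omega
  · have := Finset.single_le_sum (f := p.2) (fun i _ => Nat.zero_le _) (Finset.mem_univ a)
    omega

/-- `z^{[i]} = z₁^{i₁} ⋯ z_n^{i_n}`. -/
def multiPow {n : ℕ} (z : Fin n → ℂ) (i : Fin n → ℕ) : ℂ := ∏ j, z j ^ i j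

end

/-! Everything is read off from the time-one map `F`. Hyperbolicity and stability force all
eigenvalues `λ_j` of its derivative at `x₀` into the open unit disc, so in an adapted norm `F` is
near `x₀` a contraction `f` of rate `ρ < 1`. Two facts about the equation `φ ∘ F = c φ`, `c ≠ 0`,
then carry the proof, for `k` with `ρ ^ k < |c|`.

Uniqueness (`IsLocalModel.eq_zero_of_vanishesToOrder`): if `φ` vanishes to order `k` at `x₀`, then
near `x₀` one has `|φ(y)| = |c|⁻ᵐ |φ(Fᵐ y)| ≤ C (ρ ^ k / |c|)ᵐ` for all `m`, so `φ` vanishes there,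
and hence everywhere because every orbit enters that neighbourhood.

Existence (`IsLocalModel.exists_eigenfunction`): if `p ∘ f - c p` vanishes to order `k`, then `c⁻ᵐ
p(κ(Fᵐ x))` converges to a global solution with the same 1-jet as `p`. Locally the correction is a
series along iterates of `f`, smooth by `contDiffAt_tsum_iterate`. Nonresonance provides such a `p`
for each linear eigenform, one degree at a time (`IsCoordinateSystem.exists_formal_eigenfunction`).

The resulting `ψ_j` have differentials forming a basis of the complexified cotangent space, so any
smooth `φ` agrees to any finite order with a complex polynomial in the `ψ_j` alone; conjugates are
not needed. Monomials in `ψ` are themselves solutions with factor `λ^[i]`, and only those with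
factor `c` survive (`mem_span_eigenvectors_sup`). The difference between `φ` and this polynomial is
a solution vanishing to order `k`, hence zero.

In continuous time the generator of the linearized flow is diagonalized instead, so that the linear
eigenforms are eigenforms for all times. The defect `ψ_j ∘ Φᵗ - exp(μ_j t) ψ_j` solves the time-one
equation with factor `λ_j` and has zero 1-jet, so nonresonance kills it
(`IsLocalModel.eq_zero_of_nonresonant`). -/

/-! ### Order of vanishing at the origin. -/

/-- `f : E → ℂ` is smooth at `0` and all its derivatives of order less than `k` vanish there. -/
def VanishesToOrder {E : Type*} [NormedAddCommGroup E] [NormedSpace ℝ E] :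
    ℕ → (E → ℂ) → Prop
  | 0, f => ContDiffAt ℝ ∞ f 0
  | k + 1, f => ContDiffAt ℝ ∞ f 0 ∧ f 0 = 0 ∧
      ∀ v, VanishesToOrder k (fun x => fderiv ℝ f x v)

theorem ContDiffAt.eventually_differentiableAt {E F : Type*} [NormedAddCommGroup E]
    [NormedSpace ℝ E] [NormedAddCommGroup F] [NormedSpace ℝ F] {f : E → F} {a : E}
    (h : ContDiffAt ℝ ∞ f a) : ∀ᶠ x in 𝓝 a, DifferentiableAt ℝ f x := by
  have h1 : ContDiffAt ℝ 1 f a := h.of_le (by exact_mod_cast le_top)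
  filter_upwards [h1.eventually (by simp)] with x hx
  exact hx.differentiableAt (by simp)

theorem ContDiffAt.fderiv_infty {E F : Type*} [NormedAddCommGroup E]
    [NormedSpace ℝ E] [NormedAddCommGroup F] [NormedSpace ℝ F] {f : E → F} {a : E}
    (h : ContDiffAt ℝ ∞ f a) : ContDiffAt ℝ ∞ (fderiv ℝ f) a :=
  h.fderiv_right (by simp)

namespace VanishesToOrder

section General

variable {E : Type*} [NormedAddCommGroup E] [NormedSpace ℝ E]

theorem contDiffAt {k : ℕ} {f : E → ℂ} (h : VanishesToOrder k f) : ContDiffAt ℝ ∞ f 0 := by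
  cases k with
  | zero => exact h
  | succ k => exact h.1

theorem congr {k : ℕ} {f g : E → ℂ} (h : VanishesToOrder k f) (hfg : f =ᶠ[𝓝 0] g) :
    VanishesToOrder k g := by
  induction k generalizing f g with
  | zero => exact ContDiffAt.congr_of_eventuallyEq h hfg.symm
  | succ k ih =>
    refine ⟨h.1.congr_of_eventuallyEq hfg.symm, hfg.eq_of_nhds.symm.trans h.2.1, fun v => ?_⟩
    refine ih (h.2.2 v) ?_
    filter_upwards [hfg.fderiv (𝕜 := ℝ)] with x hx
    rw [hx]

theorem zero (k : ℕ) : VanishesToOrder k (fun _ : E => (0 : ℂ)) := by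
  induction k with
  | zero => exact contDiffAt_const
  | succ k ih => exact ⟨contDiffAt_const, rfl, fun v => by simpa using ih⟩

theorem of_succ {k : ℕ} {f : E → ℂ} (h : VanishesToOrder (k + 1) f) : VanishesToOrder k f := by
  induction k generalizing f with
  | zero => exact h.1
  | succ k ih => exact ⟨h.1, h.2.1, fun v => ih (h.2.2 v)⟩

theorem mono {k l : ℕ} (hkl : k ≤ l) {f : E → ℂ} (h : VanishesToOrder l f) :
    VanishesToOrder k f := by
  induction l, hkl using Nat.le_induction with
  | base => exact h
  | succ l _ ih => exact ih h.of_succ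

theorem add {k : ℕ} {f g : E → ℂ} (hf : VanishesToOrder k f) (hg : VanishesToOrder k g) :
    VanishesToOrder k (fun x => f x + g x) := by
  induction k generalizing f g with
  | zero => exact ContDiffAt.add hf hg
  | succ k ih =>
    refine ⟨hf.1.add hg.1, by simp [hf.2.1, hg.2.1], fun v => ?_⟩
    refine (ih (hf.2.2 v) (hg.2.2 v)).congr ?_
    filter_upwards [hf.1.eventually_differentiableAt, hg.1.eventually_differentiableAt]
      with x h1 h2
    rw [fderiv_fun_add h1 h2]; rfl

theorem mul {k l : ℕ} {f g : E → ℂ} (hf : VanishesToOrder k f) (hg : VanishesToOrder l g) :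
    VanishesToOrder (k + l) (fun x => f x * g x) := by
  induction hm : k + l generalizing k l f g with
  | zero => exact ContDiffAt.mul hf.contDiffAt hg.contDiffAt
  | succ m ih =>
    refine ⟨hf.contDiffAt.mul hg.contDiffAt, ?_, fun v => ?_⟩
    · rcases k with _ | k
      · obtain rfl : l = m + 1 := by omega
        simp [hg.2.1]
      · simp [hf.2.1]
    · have key : VanishesToOrder m
          (fun x => f x * fderiv ℝ g x v + g x * fderiv ℝ f x v) := by
        refine add ?_ ?_
        · rcases l with _ | l
          · refine ih (k := m) (l := 0) ?_ ?_ (by omega)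
            · exact hf.mono (by omega)
            · exact hg.contDiffAt.fderiv_infty.clm_apply contDiffAt_const
          · exact ih hf (hg.2.2 v) (by omega)
        · rcases k with _ | k
          · refine ih (k := m) (l := 0) ?_ ?_ (by omega)
            · exact hg.mono (by omega)
            · exact hf.contDiffAt.fderiv_infty.clm_apply contDiffAt_const
          · exact ih hg (hf.2.2 v) (by omega)
      refine key.congr ?_
      filter_upwards [hf.contDiffAt.eventually_differentiableAt,
        hg.contDiffAt.eventually_differentiableAt] with x h1 h2
      rw [fderiv_fun_mul h1 h2]
      simp

theorem const_mul {k : ℕ} {f : E → ℂ} (c : ℂ) (hf : VanishesToOrder k f) :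
    VanishesToOrder k (fun x => c * f x) := by
  have := mul (k := 0) (f := fun _ : E => c) contDiffAt_const hf
  rwa [zero_add] at this

theorem neg {k : ℕ} {f : E → ℂ} (hf : VanishesToOrder k f) :
    VanishesToOrder k (fun x => - f x) := by
  simpa using const_mul (-1) hf

theorem sub {k : ℕ} {f g : E → ℂ} (hf : VanishesToOrder k f) (hg : VanishesToOrder k g) :
    VanishesToOrder k (fun x => f x - g x) := by
  simpa [sub_eq_add_neg] using add hf (neg hg)

theorem sum {ι : Type*} {k : ℕ} (s : Finset ι) {f : ι → E → ℂ}
    (hf : ∀ i ∈ s, VanishesToOrder k (f i)) :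
    VanishesToOrder k (fun x => ∑ i ∈ s, f i x) := by
  classical
  induction s using Finset.induction_on with
  | empty => simpa using zero k
  | insert a s ha ih =>
    simp only [Finset.sum_insert ha]
    exact add (hf a (by simp)) (ih fun i hi => hf i (by simp [hi]))

theorem one_iff {f : E → ℂ} : VanishesToOrder 1 f ↔ ContDiffAt ℝ ∞ f 0 ∧ f 0 = 0 := by
  refine ⟨fun h => ⟨h.1, h.2.1⟩, fun h => ⟨h.1, h.2, fun v => ?_⟩⟩
  exact h.1.fderiv_infty.clm_apply contDiffAt_const

theorem two_of {f : E → ℂ} (h : ContDiffAt ℝ ∞ f 0) (h0 : f 0 = 0)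
    (h1 : fderiv ℝ f 0 = 0) : VanishesToOrder 2 f := by
  refine ⟨h, h0, fun v => one_iff.2 ⟨h.fderiv_infty.clm_apply contDiffAt_const, ?_⟩⟩
  simp [h1]

theorem fderiv_eq_zero {f : E → ℂ} (h : VanishesToOrder 2 f) : fderiv ℝ f 0 = 0 := by
  ext v
  exact (h.2.2 v).2.1

/-- Euler's identity for the homogeneous leading part, without Taylor polynomials. By symmetry of
the second derivative, the derivative along `v` of the degree `k + 1` expression is the degree `k`
expression for `∂_v f`, so induction applies. -/
theorem euler {k : ℕ} {f : E → ℂ} (hf : VanishesToOrder k f) :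
    VanishesToOrder (k + 1) (fun x => (k : ℂ) * f x - fderiv ℝ f x x) := by
  induction k generalizing f with
  | zero =>
    refine one_iff.2 ⟨?_, by simp⟩
    exact (contDiffAt_const.mul hf.contDiffAt).sub (hf.contDiffAt.fderiv_infty.clm_apply contDiffAt_id)
  | succ k ih =>
    refine ⟨?_, by simp [hf.2.1], fun v => ?_⟩
    · exact (contDiffAt_const.mul hf.1).sub (hf.1.fderiv_infty.clm_apply contDiffAt_id)
    · refine (ih (hf.2.2 v)).congr ?_
      have hd2 := hf.1.fderiv_infty.eventually_differentiableAt
      have hsymm : ∀ᶠ x in 𝓝 (0 : E), IsSymmSndFDerivAt ℝ f x := by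
        have h2 : ContDiffAt ℝ 2 f 0 := hf.1.of_le (by
          rw [show (2 : WithTop ℕ∞) = ((2 : ℕ∞) : WithTop ℕ∞) from rfl]; exact_mod_cast le_top)
        filter_upwards [h2.eventually (by simp)] with x hx
        exact hx.isSymmSndFDerivAt (by simp)
      filter_upwards [hf.1.eventually_differentiableAt, hd2, hsymm] with x h1 h2 h3
      have e1 : HasFDerivAt (fun x => fderiv ℝ f x x)
          ((fderiv ℝ f x).comp (ContinuousLinearMap.id ℝ E) +
            (fderiv ℝ (fderiv ℝ f) x).flip x) x :=
        h2.hasFDerivAt.clm_apply (hasFDerivAt_id x)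
      have e2 : HasFDerivAt (fun x => fderiv ℝ f x v)
          ((fderiv ℝ f x).comp (0 : E →L[ℝ] E) + (fderiv ℝ (fderiv ℝ f) x).flip v) x :=
        h2.hasFDerivAt.clm_apply (hasFDerivAt_const v x)
      have e3 : HasFDerivAt (fun x => ((k + 1 : ℕ) : ℂ) * f x - fderiv ℝ f x x)
          (((k + 1 : ℕ) : ℂ) • fderiv ℝ f x - ((fderiv ℝ f x).comp (ContinuousLinearMap.id ℝ E) +
            (fderiv ℝ (fderiv ℝ f) x).flip x)) x :=
        (h1.hasFDerivAt.const_mul _).sub e1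
      rw [e3.fderiv, e2.fderiv]
      simp [h3 v x]
      ring

/-- Induction on the order: the derivative is controlled by its values on a basis, then the mean
value inequality on the closed ball of radius `‖x‖` gains one power. -/
theorem isBigO {k : ℕ} {f : E → ℂ} (hf : VanishesToOrder k f) [FiniteDimensional ℝ E] :
    f =O[𝓝 0] fun x => ‖x‖ ^ k := by
  induction k generalizing f with
  | zero =>
    simpa using hf.contDiffAt.continuousAt.tendsto.isBigO_one ℝ
  | succ k ih =>
    have hD : (fderiv ℝ f) =O[𝓝 0] fun x : E => ‖x‖ ^ k := by
      let b := Module.finBasis ℝ E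
      have : ∃ C, ∀ T : E →L[ℝ] ℂ, ‖T‖ ≤ C * ∑ l, ‖T (b l)‖ := by
        obtain ⟨C, hC0, hC⟩ := b.exists_opNorm_le (F := ℂ)
        refine ⟨C, fun T => hC (Finset.sum_nonneg fun _ _ => norm_nonneg _) fun i => ?_⟩
        exact Finset.single_le_sum (f := fun l => ‖T (b l)‖) (fun _ _ => norm_nonneg _)
          (Finset.mem_univ i)
      obtain ⟨C, hC⟩ := this
      have h1 : (fderiv ℝ f) =O[𝓝 0] fun x => ∑ l, ‖fderiv ℝ f x (b l)‖ := by
        refine Asymptotics.IsBigO.of_bound C (Eventually.of_forall fun x => ?_)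
        rw [Real.norm_of_nonneg (Finset.sum_nonneg fun _ _ => norm_nonneg _)]
        exact hC _
      exact h1.trans (Asymptotics.IsBigO.fun_sum fun l _ => (ih (hf.2.2 (b l))).norm_left)
    obtain ⟨C, hC⟩ := hD.bound
    have hd := hf.1.eventually_differentiableAt
    obtain ⟨δ, hδ, hball⟩ := Metric.eventually_nhds_iff_ball.1 (hC.and hd)
    refine Asymptotics.IsBigO.of_bound C ?_
    filter_upwards [Metric.ball_mem_nhds (0 : E) hδ] with x hx
    have hC0 : ∀ y ∈ Metric.closedBall (0 : E) ‖x‖, ‖fderiv ℝ f y‖ ≤ C * ‖x‖ ^ k := by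
      intro y hy
      rw [mem_closedBall_zero_iff] at hy
      rw [mem_ball_zero_iff] at hx
      have hb := (hball y (by rw [mem_ball_zero_iff]; exact hy.trans_lt hx)).1
      have hx' := (hball x (by rwa [mem_ball_zero_iff])).1
      rw [norm_pow, norm_norm] at hb hx'
      -- The constant comes from an `O`-bound and has no sign; if it is negative, the bound at `x`
      -- forces `‖x‖ ^ k = 0`.
      rcases le_or_gt 0 C with h | h
      · exact hb.trans (by gcongr)
      · have h2 : ‖x‖ ^ k ≤ 0 := by
          by_contra hcon
          have := mul_neg_of_neg_of_pos h (not_le.1 hcon)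
          linarith [norm_nonneg (fderiv ℝ f x)]
        have h3 : ‖x‖ ^ k = 0 := le_antisymm h2 (by positivity)
        have h4 : ‖y‖ ^ k ≤ 0 := h3 ▸ pow_le_pow_left₀ (norm_nonneg _) hy k
        have h5 : ‖y‖ ^ k = 0 := le_antisymm h4 (by positivity)
        rw [h3]; rw [h5] at hb; exact hb
    have := (convex_closedBall (0 : E) ‖x‖).norm_image_sub_le_of_norm_fderiv_le (𝕜 := ℝ)
      (f := f) (C := C * ‖x‖ ^ k) (fun y hy => (hball y (by
        rw [mem_closedBall_zero_iff] at hy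
        rw [mem_ball_zero_iff] at hx ⊢
        exact hy.trans_lt hx)).2) hC0 (x := 0) (y := x) (by simp) (by simp)
    rw [hf.2.1, sub_zero, sub_zero] at this
    rw [norm_pow, norm_norm, pow_succ, ← mul_assoc]
    exact this

end General

section Comp

variable {E E' : Type*} [NormedAddCommGroup E] [NormedSpace ℝ E] [FiniteDimensional ℝ E]
  [NormedAddCommGroup E'] [NormedSpace ℝ E']

theorem fderiv_apply_eq_sum (f : E → ℂ) (x v : E) :
    fderiv ℝ f x v = ∑ l, (((Module.finBasis ℝ E).coord l v : ℝ) : ℂ) *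
      fderiv ℝ f x (Module.finBasis ℝ E l) := by
  conv_lhs => rw [← (Module.finBasis ℝ E).sum_repr v]
  simp only [map_sum, map_smul, Complex.real_smul, Module.Basis.coord_apply]

theorem contDiff_coord (l : Fin (Module.finrank ℝ E)) :
    ContDiff ℝ ∞ (fun v : E => (((Module.finBasis ℝ E).coord l v : ℝ) : ℂ)) :=
  Complex.ofRealCLM.contDiff.comp
    (LinearMap.toContinuousLinearMap ((Module.finBasis ℝ E).coord l)).contDiff

theorem comp {k : ℕ} {f : E → ℂ} (hf : VanishesToOrder k f) {F : E' → E}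
    (hF : ContDiffAt ℝ ∞ F 0) (hF0 : F 0 = 0) : VanishesToOrder k (fun x => f (F x)) := by
  have hcomp : ∀ {g : E → ℂ}, ContDiffAt ℝ ∞ g 0 → ContDiffAt ℝ ∞ (fun x => g (F x)) 0 :=
    fun hg => ContDiffAt.comp (0 : E') (by rwa [hF0]) hF
  induction k generalizing f with
  | zero => exact hcomp hf
  | succ k ih =>
    refine ⟨hcomp hf.1, by simp [hF0, hf.2.1], fun v => ?_⟩
    have key : VanishesToOrder k (fun x => ∑ l,
        (((Module.finBasis ℝ E).coord l (fderiv ℝ F x v) : ℝ) : ℂ) *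
          fderiv ℝ f (F x) (Module.finBasis ℝ E l)) := by
      refine sum _ fun l _ => ?_
      rw [← zero_add k]
      refine mul (k := 0) ?_ (ih (hf.2.2 _))
      exact ContDiffAt.comp (0 : E') (contDiff_coord l).contDiffAt
        (hF.fderiv_infty.clm_apply contDiffAt_const)
    refine key.congr ?_
    have hF' := hF.continuousAt.tendsto
    rw [hF0] at hF'
    filter_upwards [hF'.eventually hf.1.eventually_differentiableAt,
      hF.eventually_differentiableAt] with x h1 h2
    rw [← fderiv_apply_eq_sum, fderiv_fun_comp x h1 h2]
    rfl

/-- Differentiating costs one order, and linearity in the second variable gives it back. Hence the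
tangent version of a remainder satisfies the same hypothesis as the remainder. -/
theorem fderiv_prod {k : ℕ} {f : E → ℂ} (hf : VanishesToOrder k f) (hk : 1 ≤ k) :
    VanishesToOrder k (fun p : E × E => fderiv ℝ f p.1 p.2) := by
  obtain ⟨k, rfl⟩ := Nat.exists_eq_add_of_le' hk
  have key : VanishesToOrder (k + 1) (fun p : E × E => ∑ l,
        (((Module.finBasis ℝ E).coord l p.2 : ℝ) : ℂ) *
          fderiv ℝ f p.1 (Module.finBasis ℝ E l)) := by
    refine sum _ fun l _ => ?_
    rw [add_comm k 1]
    refine mul (k := 1) (one_iff.2 ⟨?_, by simp⟩) ((hf.2.2 _).comp contDiffAt_fst rfl)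
    exact ((contDiff_coord l).comp contDiff_snd).contDiffAt
  refine key.congr (Eventually.of_forall fun p => ?_)
  exact (fderiv_apply_eq_sum f p.1 p.2).symm

end Comp

end VanishesToOrder

/-! ### Expansion in monomials of a complex coordinate system. -/

/-- The functions vanishing to order `k` at `0`, as a complex subspace of all functions. -/
def vanishingSubmodule (E : Type*) [NormedAddCommGroup E] [NormedSpace ℝ E] (k : ℕ) :
    Submodule ℂ (E → ℂ) where
  carrier := {f | VanishesToOrder k f}
  add_mem' hf hg := hf.add hg
  zero_mem' := VanishesToOrder.zero k
  smul_mem' c _ hf := hf.const_mul c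

/-- The monomial `u^{[i]}` in a tuple of functions. -/
def monomialFun {X : Type*} {n : ℕ} (u : Fin n → X → ℂ) (i : Fin n → ℕ) : X → ℂ :=
  fun x => multiPow (fun j => u j x) i

theorem multiPow_add_single {n : ℕ} (z : Fin n → ℂ) (i : Fin n → ℕ) (l : Fin n) :
    multiPow z (i + Pi.single l 1) = z l * multiPow z i := by
  simp only [multiPow, Pi.add_apply, pow_add, Finset.prod_mul_distrib]
  rw [mul_comm]
  congr 1
  rw [Finset.prod_eq_single l] <;> simp +contextual

theorem exists_eq_add_single {n k : ℕ} {i : Fin n → ℕ} (hi : ∑ j, i j = k + 1) :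
    ∃ (l : Fin n) (i' : Fin n → ℕ), i = i' + Pi.single l 1 ∧ ∑ j, i' j = k := by
  obtain ⟨l, -, hl⟩ : ∃ l ∈ Finset.univ, i l ≠ 0 := by
    by_contra! h
    simp [Finset.sum_eq_zero h] at hi
  have h1 : i = (i - Pi.single l 1) + Pi.single l 1 := by
    ext j
    by_cases hj : j = l
    · subst hj; simp; omega
    · simp [hj]
  refine ⟨l, i - Pi.single l 1, h1, ?_⟩
  have h2 : ∑ j, (Pi.single l 1 : Fin n → ℕ) j = 1 := by simp
  have h3 := congrArg (fun i : Fin n → ℕ => ∑ j, i j) h1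
  simp only [Pi.add_apply, Finset.sum_add_distrib] at h3
  simp only [h2] at h3
  omega

theorem sum_add_single {n : ℕ} (i : Fin n → ℕ) (l : Fin n) :
    ∑ j, (i + Pi.single l 1 : Fin n → ℕ) j = ∑ j, i j + 1 := by
  simp [Finset.sum_add_distrib]

/-- The span of the monomials of degree `k`. -/
def homogeneousSpan {X : Type*} {n : ℕ} (u : Fin n → X → ℂ) (k : ℕ) : Submodule ℂ (X → ℂ) :=
  Submodule.span ℂ (monomialFun u '' {i | ∑ j, i j = k})

theorem mul_mem_homogeneousSpan {X : Type*} {n : ℕ} {u : Fin n → X → ℂ} (l : Fin n) {k : ℕ}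
    {g : X → ℂ} (hg : g ∈ homogeneousSpan u k) :
    (fun x => u l x * g x) ∈ homogeneousSpan u (k + 1) := by
  have : homogeneousSpan u k ≤ (homogeneousSpan u (k + 1)).comap
      (LinearMap.mulLeft ℂ (u l)) := by
    refine Submodule.span_le.2 ?_
    rintro _ ⟨i, hi, rfl⟩
    refine Submodule.subset_span ⟨i + Pi.single l 1, ?_, ?_⟩
    · exact (sum_add_single i l).trans (congrArg (· + 1) hi)
    · ext x
      exact multiPow_add_single _ _ _
  exact this hg

section Expansion

variable {E : Type*} [NormedAddCommGroup E] [NormedSpace ℝ E] {n : ℕ}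

/-- Complex-valued functions `u₁, …, u_n` that are smooth at `0`, vanish there, and whose
differentials at `0` span the complexified cotangent space. -/
structure IsCoordinateSystem (u : Fin n → E → ℂ) : Prop where
  contDiffAt : ∀ j, ContDiffAt ℝ ∞ (u j) 0
  map_zero : ∀ j, u j 0 = 0
  exists_sum : ∀ ξ : E →L[ℝ] ℂ, ∃ a : Fin n → ℂ, ξ = ∑ j, a j • fderiv ℝ (u j) 0

variable {u : Fin n → E → ℂ}

theorem IsCoordinateSystem.vanishesToOrder_monomialFun (hu : IsCoordinateSystem u) {k : ℕ}
    {i : Fin n → ℕ} (hi : ∑ j, i j = k) : VanishesToOrder k (monomialFun u i) := by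
  induction k generalizing i with
  | zero =>
    change ContDiffAt ℝ ∞ (fun x => ∏ j, u j x ^ i j) 0
    exact contDiffAt_prod fun j _ => (hu.contDiffAt j).pow _
  | succ k ih =>
    obtain ⟨l, i', rfl, h⟩ := exists_eq_add_single hi
    have := (VanishesToOrder.one_iff.2 ⟨hu.contDiffAt l, hu.map_zero l⟩).mul (ih h)
    rw [add_comm] at this
    refine this.congr (Eventually.of_forall fun x => ?_)
    exact (multiPow_add_single (fun j => u j x) i' l).symm

/-- By `VanishesToOrder.euler`, `(k + 1) f` is `∑ x_l ∂_l f` modulo higher order. Replace each `∂_l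
f` by its leading part (induction) and each real coordinate `x_l` by the combination of the `u_j`
with the same differential. -/
theorem IsCoordinateSystem.exists_leading [FiniteDimensional ℝ E] (hu : IsCoordinateSystem u) {k : ℕ} {f : E → ℂ}
    (hf : VanishesToOrder k f) :
    ∃ g ∈ homogeneousSpan u k, VanishesToOrder (k + 1) (fun x => f x - g x) := by
  induction k generalizing f with
  | zero =>
    refine ⟨fun _ => f 0, ?_, VanishesToOrder.one_iff.2 ⟨hf.contDiffAt.sub contDiffAt_const, by simp⟩⟩
    have : (fun _ => f 0 : E → ℂ) = f 0 • monomialFun u 0 := by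
      ext x; simp [monomialFun, multiPow]
    rw [this]
    exact Submodule.smul_mem _ _ (Submodule.subset_span ⟨0, by simp, rfl⟩)
  | succ k ih =>
    let b := Module.finBasis ℝ E
    choose g hg hfg using fun l => ih (hf.2.2 (b l))
    let x' : Fin (Module.finrank ℝ E) → E →L[ℝ] ℂ := fun l =>
      Complex.ofRealCLM.comp (LinearMap.toContinuousLinearMap (b.coord l))
    choose a ha using fun l => hu.exists_sum (x' l)
    have hxl : ∀ l, VanishesToOrder 2 (fun x => x' l x - ∑ j, a l j * u j x) := by
      intro l
      refine VanishesToOrder.two_of ?_ ?_ ?_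
      · exact (x' l).contDiff.contDiffAt.sub
          (ContDiffAt.sum fun j _ => contDiffAt_const.mul (hu.contDiffAt j))
      · simp [hu.map_zero]
      · have : HasFDerivAt (fun x => x' l x - ∑ j, a l j * u j x)
            (x' l - ∑ j, a l j • fderiv ℝ (u j) 0) 0 :=
          (x' l).hasFDerivAt.sub (HasFDerivAt.fun_sum fun j _ =>
            (((hu.contDiffAt j).differentiableAt (by simp)).hasFDerivAt).const_mul (a l j))
        rw [this.fderiv, ← ha l, sub_self]
    have hk : ((k + 1 : ℕ) : ℂ) ≠ 0 := by exact_mod_cast Nat.succ_ne_zero k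
    refine ⟨fun x => ((k + 1 : ℕ) : ℂ)⁻¹ * ∑ l, ∑ j, a l j * (u j x * g l x), ?_, ?_⟩
    · have : (fun x => ((k + 1 : ℕ) : ℂ)⁻¹ * ∑ l, ∑ j, a l j * (u j x * g l x)) =
          ((k + 1 : ℕ) : ℂ)⁻¹ • ∑ l, ∑ j, a l j • (fun x => u j x * g l x) := by
        ext x; simp
      rw [this]
      exact Submodule.smul_mem _ _ (Submodule.sum_mem _ fun l _ => Submodule.sum_mem _ fun j _ =>
        Submodule.smul_mem _ _ (mul_mem_homogeneousSpan j (hg l)))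
    · have e1 := hf.euler
      have e2 : VanishesToOrder (k + 1 + 1) (fun x => ∑ l,
          ((x' l x - ∑ j, a l j * u j x) * fderiv ℝ f x (b l) +
            (∑ j, a l j * u j x) * (fderiv ℝ f x (b l) - g l x))) := by
        refine VanishesToOrder.sum _ fun l _ => VanishesToOrder.add ?_ ?_
        · rw [show k + 1 + 1 = 2 + k by ring]
          exact (hxl l).mul (hf.2.2 (b l))
        · rw [add_comm (k + 1) 1]
          refine VanishesToOrder.mul (k := 1) ?_ (hfg l)
          exact VanishesToOrder.sum _ fun j _ =>
            (VanishesToOrder.one_iff.2 ⟨hu.contDiffAt j, hu.map_zero j⟩).const_mul _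
      refine ((e1.add e2).const_mul ((k + 1 : ℕ) : ℂ)⁻¹).congr (Eventually.of_forall fun x => ?_)
      have e3 : fderiv ℝ f x x = ∑ l, x' l x * fderiv ℝ f x (b l) :=
        VanishesToOrder.fderiv_apply_eq_sum f x x
      have e4 : ∑ l, ((x' l x - ∑ j, a l j * u j x) * fderiv ℝ f x (b l) +
            (∑ j, a l j * u j x) * (fderiv ℝ f x (b l) - g l x)) =
          fderiv ℝ f x x - ∑ l, ∑ j, a l j * (u j x * g l x) := by
        rw [e3, ← Finset.sum_sub_distrib]
        refine Finset.sum_congr rfl fun l _ => ?_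
        have : ∑ j, a l j * (u j x * g l x) = (∑ j, a l j * u j x) * g l x := by
          rw [Finset.sum_mul]
          exact Finset.sum_congr rfl fun j _ => by ring
        rw [this]; ring
      simp only [e4]
      field_simp
      ring

theorem IsCoordinateSystem.mem_span_sup [FiniteDimensional ℝ E] (hu : IsCoordinateSystem u) {f : E → ℂ}
    (hf : ContDiffAt ℝ ∞ f 0) (k : ℕ) :
    f ∈ Submodule.span ℂ (range (monomialFun u)) ⊔ vanishingSubmodule E k := by
  induction k with
  | zero => exact Submodule.mem_sup_right hf
  | succ k ih =>
    obtain ⟨p, hp, r, hr, rfl⟩ := Submodule.mem_sup.1 ih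
    obtain ⟨g, hg, hrg⟩ := hu.exists_leading hr
    have : p + r = (p + g) + (fun x => r x - g x) := by ext x; simp
    rw [this]
    refine Submodule.add_mem_sup (Submodule.add_mem _ hp ?_) hrg
    exact Submodule.span_mono (image_subset_range _ _) hg

end Expansion

/-! ### Smoothness of series along the iterates of a contraction. -/

theorem norm_iterate_le {E : Type*} [NormedAddCommGroup E] {f : E → E} {ρ δ : ℝ} (hρ0 : 0 ≤ ρ) (hρ1 : ρ ≤ 1)
    (hf : ∀ x ∈ Metric.ball (0 : E) δ, ‖f x‖ ≤ ρ * ‖x‖) {x : E} (hx : x ∈ Metric.ball (0 : E) δ)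
    (m : ℕ) : ‖f^[m] x‖ ≤ ρ ^ m * ‖x‖ := by
  induction m with
  | zero => simp
  | succ m ih =>
    rw [Function.iterate_succ_apply', pow_succ']
    have h1 : f^[m] x ∈ Metric.ball (0 : E) δ := by
      rw [mem_ball_zero_iff] at hx ⊢
      refine ih.trans_lt (lt_of_le_of_lt ?_ hx)
      exact mul_le_of_le_one_left (norm_nonneg _) (pow_le_one₀ hρ0 hρ1)
    calc _ ≤ ρ * ‖f^[m] x‖ := hf _ h1
      _ ≤ ρ * (ρ ^ m * ‖x‖) := by gcongr
      _ = _ := by ring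

section Series

variable {E : Type*} [NormedAddCommGroup E] [NormedSpace ℝ E]

theorem eventually_norm_le_of_norm_fderiv_lt {f : E → E} {ρ : ℝ} (hf : DifferentiableAt ℝ f 0)
    (hf0 : f 0 = 0) (hρ : ‖fderiv ℝ f 0‖ < ρ) : ∀ᶠ x in 𝓝 0, ‖f x‖ ≤ ρ * ‖x‖ := by
  have h := hf.hasFDerivAt.isLittleO.bound (sub_pos.2 hρ)
  filter_upwards [h] with x hx
  simp only [hf0, sub_zero] at hx
  calc ‖f x‖ = ‖(f x - fderiv ℝ f 0 x) + fderiv ℝ f 0 x‖ := by simp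
    _ ≤ ‖f x - fderiv ℝ f 0 x‖ + ‖fderiv ℝ f 0 x‖ := norm_add_le _ _
    _ ≤ (ρ - ‖fderiv ℝ f 0‖) * ‖x‖ + ‖fderiv ℝ f 0‖ * ‖x‖ :=
      add_le_add hx (ContinuousLinearMap.le_opNorm _ _)
    _ = ρ * ‖x‖ := by ring

/-- The tangent map of `f : E → E`. -/
noncomputable def tangentStep (f : E → E) (p : E × E) : E × E := (f p.1, fderiv ℝ f p.1 p.2)

theorem contDiffAt_tangentStep {f : E → E} (hf : ContDiffAt ℝ ∞ f 0) :
    ContDiffAt ℝ ∞ (tangentStep f) 0 := by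
  have h1 : ContDiffAt ℝ ∞ (fun p : E × E => p.1) 0 := contDiffAt_fst
  refine ContDiffAt.prodMk (ContDiffAt.comp (0 : E × E) hf h1) ?_
  exact (ContDiffAt.comp (0 : E × E) (g := fderiv ℝ f) hf.fderiv_infty h1).clm_apply contDiffAt_snd

/-- At the origin the second-derivative term is applied to the zero vector, leaving two diagonal
copies of `Df(0)`; the product carries the max norm. So the contraction rate is not lost on passing
to the tangent map. -/
theorem norm_fderiv_tangentStep_le {f : E → E} (hf : ContDiffAt ℝ ∞ f 0) :
    ‖fderiv ℝ (tangentStep f) 0‖ ≤ ‖fderiv ℝ f 0‖ := by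
  have h1 : HasFDerivAt (fun p : E × E => f p.1)
      ((fderiv ℝ f 0).comp (ContinuousLinearMap.fst ℝ E E)) 0 :=
    HasFDerivAt.comp (0 : E × E) (g := f) (hf.differentiableAt (by simp)).hasFDerivAt hasFDerivAt_fst
  have h2 : HasFDerivAt (fun p : E × E => fderiv ℝ f p.1)
      ((fderiv ℝ (fderiv ℝ f) 0).comp (ContinuousLinearMap.fst ℝ E E)) 0 :=
    HasFDerivAt.comp (0 : E × E) (g := fderiv ℝ f)
      (hf.fderiv_infty.differentiableAt (by simp)).hasFDerivAt hasFDerivAt_fst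
  have h3 := h1.prodMk (h2.clm_apply hasFDerivAt_snd)
  have h4 : HasFDerivAt (tangentStep f) _ 0 := h3
  rw [h4.fderiv]
  refine ContinuousLinearMap.opNorm_le_bound _ (norm_nonneg _) fun p => ?_
  simp only [ContinuousLinearMap.prod_apply, ContinuousLinearMap.comp_apply,
    Prod.norm_def, Prod.snd_zero,
    map_zero, add_zero, ContinuousLinearMap.coe_fst', ContinuousLinearMap.coe_snd', Prod.fst_zero]
  refine max_le ((ContinuousLinearMap.le_opNorm _ _).trans ?_)
    ((ContinuousLinearMap.le_opNorm _ _).trans ?_)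
  · gcongr; exact le_max_left _ _
  · gcongr; exact le_max_right _ _

/-- The chain rule in the form that lets the differentiated series be a series of the same kind, for
the tangent map and the function `(x, v) ↦ DR(x) v`. -/
theorem hasFDerivAt_comp_iterate {f : E → E} {R : E → ℂ} {s : Set E} (hs : MapsTo f s s)
    (hf : ∀ x ∈ s, DifferentiableAt ℝ f x) (hR : ∀ x ∈ s, DifferentiableAt ℝ R x) (m : ℕ) {x : E}
    (hx : x ∈ s) : DifferentiableAt ℝ (fun x => R (f^[m] x)) x ∧
      ∀ v, fderiv ℝ (fun x => R (f^[m] x)) x v =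
        fderiv ℝ R ((tangentStep f)^[m] (x, v)).1 ((tangentStep f)^[m] (x, v)).2 := by
  induction m generalizing x with
  | zero => exact ⟨hR x hx, fun v => rfl⟩
  | succ m ih =>
    obtain ⟨h1, h2⟩ := ih (hs hx)
    have e : (fun x => R (f^[m + 1] x)) = fun x => (fun y => R (f^[m] y)) (f x) := rfl
    refine ⟨e ▸ h1.comp x (hf x hx), fun v => ?_⟩
    rw [e, fderiv_fun_comp x h1 (hf x hx), ContinuousLinearMap.comp_apply, h2]
    rfl

variable [FiniteDimensional ℝ E]

/-- Termwise differentiation: the `m`-th derivative term is `O((ρ ^ k ‖c‖) ^ m)` uniformly on a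
small ball, a geometric majorant. -/
theorem exists_ball_hasFDerivAt_tsum {f : E → E} {R : E → ℂ} {k : ℕ} {c : ℂ} {ρ : ℝ}
    (hf : ContDiffAt ℝ ∞ f 0) (hf0 : f 0 = 0) (hρ : ‖fderiv ℝ f 0‖ < ρ) (hρ1 : ρ < 1)
    (hk : 1 ≤ k) (hc : ρ ^ k * ‖c‖ < 1) (hR : VanishesToOrder k R) :
    ∃ δ > 0, ∀ x ∈ Metric.ball (0 : E) δ, Summable (fun m : ℕ => c ^ m * R (f^[m] x)) ∧
      ∃ S' : E →L[ℝ] ℂ, HasFDerivAt (fun x => ∑' m : ℕ, c ^ m * R (f^[m] x)) S' x ∧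
        ∀ v, S' v = ∑' m : ℕ, c ^ m *
          fderiv ℝ R ((tangentStep f)^[m] (x, v)).1 ((tangentStep f)^[m] (x, v)).2 := by
  have hρ0 : 0 ≤ ρ := (norm_nonneg _).trans hρ.le
  have hT := eventually_norm_le_of_norm_fderiv_lt
    ((contDiffAt_tangentStep hf).differentiableAt (by simp)) (by simp [tangentStep, hf0])
    ((norm_fderiv_tangentStep_le hf).trans_lt hρ)
  obtain ⟨C, hC0, hC⟩ := (hR.fderiv_prod hk).isBigO.exists_pos
  obtain ⟨δ, hδ, h1⟩ := Metric.eventually_nhds_iff_ball.1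
    ((eventually_norm_le_of_norm_fderiv_lt (hf.differentiableAt (by simp)) hf0 hρ).and
    (hf.eventually_differentiableAt.and hR.contDiffAt.eventually_differentiableAt))
  obtain ⟨δ', hδ', h2⟩ := Metric.eventually_nhds_iff_ball.1 (hT.and hC.bound)
  let d := min δ δ'
  have hd : 0 < d := lt_min hδ hδ'
  have hball : Metric.ball (0 : E) d ⊆ Metric.ball 0 δ := Metric.ball_subset_ball (min_le_left _ _)
  have hball' : Metric.ball (0 : E × E) d ⊆ Metric.ball 0 δ' :=
    Metric.ball_subset_ball (min_le_right _ _)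
  have hmaps : MapsTo f (Metric.ball 0 d) (Metric.ball 0 d) := by
    intro x hx
    have := (h1 x (hball hx)).1
    rw [mem_ball_zero_iff] at hx ⊢
    exact (this.trans (mul_le_of_le_one_left (norm_nonneg _) hρ1.le)).trans_lt hx
  let g : ℕ → E → ℂ := fun m x => c ^ m * R (f^[m] x)
  let g' : ℕ → E → E →L[ℝ] ℂ := fun m x => c ^ m • fderiv ℝ (fun x => R (f^[m] x)) x
  have hiter := fun (m : ℕ) {x : E} (hx : x ∈ Metric.ball (0 : E) d) =>
    hasFDerivAt_comp_iterate (R := R) hmaps (fun x hx => (h1 x (hball hx)).2.1)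
      (fun x hx => (h1 x (hball hx)).2.2) m hx
  have hg : ∀ m x, x ∈ Metric.ball (0 : E) d → HasFDerivAt (g m) (g' m x) x := fun m x hx =>
    (hiter m hx).1.hasFDerivAt.const_mul (c ^ m)
  let u : ℕ → ℝ := fun m => (2 / d * (C * d ^ k)) * (ρ ^ k * ‖c‖) ^ m
  have hu : Summable u := (summable_geometric_of_lt_one (by positivity) hc).mul_left _
  have hg' : ∀ m x, x ∈ Metric.ball (0 : E) d → ‖g' m x‖ ≤ u m := by
    intro m x hx
    refine ContinuousLinearMap.opNorm_le_of_unit_norm (by positivity) fun v hv => ?_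
    -- The contraction estimate for the tangent map holds only near the origin, so the unit vector
    -- is shrunk into the ball and the factor `2 / d` restored by linearity.
    have hp : (x, (d / 2) • v) ∈ Metric.ball (0 : E × E) d := by
      rw [mem_ball_zero_iff] at hx ⊢
      rw [Prod.norm_def]
      refine max_lt hx ?_
      rw [norm_smul, hv, mul_one, Real.norm_of_nonneg (by positivity)]
      linarith
    have hpd := mem_ball_zero_iff.1 hp
    have e1 := norm_iterate_le hρ0 hρ1.le (fun p hp => (h2 p (hball' hp)).1) hp m
    set q := (tangentStep f)^[m] (x, (d / 2) • v) with hq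
    have e1' : ‖q‖ ≤ ρ ^ m * d := e1.trans (by gcongr)
    have hqd : q ∈ Metric.ball (0 : E × E) d := by
      rw [mem_ball_zero_iff]
      exact (e1.trans (mul_le_of_le_one_left (norm_nonneg _) (pow_le_one₀ hρ0 hρ1.le))).trans_lt hpd
    have e2 := (h2 q (hball' hqd)).2
    rw [norm_pow, norm_norm] at e2
    have e3 : g' m x ((d / 2) • v) = c ^ m * fderiv ℝ R q.1 q.2 := by
      simp only [g', smul_apply, (hiter m hx).2, smul_eq_mul, hq]
    have e4 : ‖g' m x v‖ = 2 / d * ‖g' m x ((d / 2) • v)‖ := by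
      rw [map_smul, norm_smul, Real.norm_of_nonneg (by positivity)]
      field_simp
    rw [e4, e3, norm_mul, norm_pow]
    calc 2 / d * (‖c‖ ^ m * ‖fderiv ℝ R q.1 q.2‖)
        ≤ 2 / d * (‖c‖ ^ m * (C * (ρ ^ m * d) ^ k)) := by
          gcongr; exact e2.trans (by gcongr)
      _ = u m := by
          simp only [u]; ring
  have hz : Summable (g · 0) := by
    have : ∀ m, f^[m] 0 = 0 := fun m => Function.iterate_fixed hf0 m
    simp only [g, this, ((hR.mono hk).2.1 : R 0 = 0), mul_zero]
    exact summable_zero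
  have hpre : IsPreconnected (Metric.ball (0 : E) d) := (convex_ball 0 d).isPreconnected
  refine ⟨d, hd, fun x hx => ⟨?_, ∑' m, g' m x, ?_, fun v => ?_⟩⟩
  · exact summable_of_summable_hasFDerivAt_of_isPreconnected hu Metric.isOpen_ball hpre hg hg'
      (Metric.mem_ball_self hd) hz hx
  · exact hasFDerivAt_tsum_of_isPreconnected hu Metric.isOpen_ball hpre hg hg'
      (Metric.mem_ball_self hd) hz hx
  · have hs : Summable (fun m => g' m x) := Summable.of_norm_bounded hu fun m => hg' m x hx
    have := (ContinuousLinearMap.apply ℝ ℂ v).map_tsum hs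
    simp only [ContinuousLinearMap.apply_apply] at this
    rw [this]
    refine tsum_congr fun m => ?_
    simp only [g', smul_apply, (hiter m hx).2, smul_eq_mul]

end Series

theorem contDiffAt_of_forall_apply {D E : Type*} [NormedAddCommGroup D] [NormedSpace ℝ D]
    [NormedAddCommGroup E] [NormedSpace ℝ E] [FiniteDimensional ℝ E] {n : WithTop ℕ∞}
    {f : D → E →L[ℝ] ℂ} {a : D} (h : ∀ v, ContDiffAt ℝ n (fun x => f x v) a) :
    ContDiffAt ℝ n f a := by
  let e₁ := ContinuousLinearEquiv.ofFinrankEq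
    (Module.finrank_fin_fun (n := Module.finrank ℝ E) ℝ).symm
  let e₂ := (e₁.arrowCongr (1 : ℂ ≃L[ℝ] ℂ)).trans
    (ContinuousLinearEquiv.piRing (Fin (Module.finrank ℝ E)))
  rw [← Function.id_comp f, ← e₂.symm_comp_self]
  exact e₂.symm.contDiff.contDiffAt.comp a (contDiffAt_pi.2 fun i => h _)

/-- Induction on `r` over all spaces at once: the first derivative of the series on `E` is the
series for the tangent map on `E × E`, which has the same `k`, `c` and `ρ`. No higher-order chain
rule is required. -/
theorem contDiffAt_tsum_iterate (r : ℕ) {E : Type*} [NormedAddCommGroup E] [NormedSpace ℝ E]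
    [FiniteDimensional ℝ E] {f : E → E} {R : E → ℂ} {k : ℕ} {c : ℂ} {ρ : ℝ}
    (hf : ContDiffAt ℝ ∞ f 0) (hf0 : f 0 = 0) (hρ : ‖fderiv ℝ f 0‖ < ρ) (hρ1 : ρ < 1)
    (hk : 1 ≤ k) (hc : ρ ^ k * ‖c‖ < 1) (hR : VanishesToOrder k R) :
    ContDiffAt ℝ r (fun x => ∑' m : ℕ, c ^ m * R (f^[m] x)) 0 := by
  induction r generalizing E with
  | zero =>
    obtain ⟨δ, hδ, h⟩ := exists_ball_hasFDerivAt_tsum hf hf0 hρ hρ1 hk hc hR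
    refine contDiffAt_zero.2 ⟨_, Metric.ball_mem_nhds 0 hδ, fun x hx => ?_⟩
    obtain ⟨-, S', hS, -⟩ := h x hx
    exact hS.continuousAt.continuousWithinAt
  | succ r ih =>
    obtain ⟨δ, hδ, h⟩ := exists_ball_hasFDerivAt_tsum hf hf0 hρ hρ1 hk hc hR
    have hT := ih (contDiffAt_tangentStep hf) (by simp [tangentStep, hf0])
      ((norm_fderiv_tangentStep_le hf).trans_lt hρ) (hR.fderiv_prod hk)
    set S : E → ℂ := fun x => ∑' m : ℕ, c ^ m * R (f^[m] x)
    set T : E × E → ℂ := fun p => ∑' m : ℕ, c ^ m *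
      fderiv ℝ R ((tangentStep f)^[m] p).1 ((tangentStep f)^[m] p).2
    have hST : ∀ x ∈ Metric.ball (0 : E) δ, HasFDerivAt S (fderiv ℝ S x) x ∧
        ∀ v, fderiv ℝ S x v = T (x, v) := by
      intro x hx
      obtain ⟨-, S', hS, hv⟩ := h x hx
      rw [hS.fderiv]
      exact ⟨hS, hv⟩
    rw [show ((r + 1 : ℕ) : WithTop ℕ∞) = (r : WithTop ℕ∞) + 1 by push_cast; rfl,
      contDiffAt_succ_iff_hasFDerivAt]
    refine ⟨fderiv ℝ S, ⟨_, Metric.ball_mem_nhds 0 hδ, fun x hx => (hST x hx).1⟩, ?_⟩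
    refine contDiffAt_of_forall_apply fun v => ?_
    obtain ⟨ε, hε, hTε⟩ := Metric.eventually_nhds_iff_ball.1 (hT.eventually (by simp))
    -- The induction hypothesis gives regularity of `T` only near the origin; linearity of the
    -- derivative in `v` permits evaluation at a small multiple of `v`.
    obtain ⟨t, ht, htv⟩ : ∃ t : ℝ, 0 < t ∧ ‖t • v‖ < ε := by
      refine ⟨ε / (‖v‖ + 1), by positivity, ?_⟩
      rw [norm_smul, Real.norm_of_nonneg (by positivity), div_mul_eq_mul_div,
        div_lt_iff₀ (by positivity)]
      nlinarith [norm_nonneg v]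
    have h1 : ContDiffAt ℝ r T (0, t • v) := hTε _ (by
      rw [mem_ball_zero_iff, Prod.norm_def]
      exact max_lt (by simpa using hε) htv)
    have h2 : ContDiffAt ℝ r (fun x : E => T (x, t • v)) 0 :=
      ContDiffAt.comp (0 : E) h1 (contDiffAt_id.prodMk contDiffAt_const)
    have h3 : ContDiffAt ℝ r (fun x : E => t⁻¹ • T (x, t • v)) 0 := h2.const_smul t⁻¹
    refine h3.congr_of_eventuallyEq ?_
    filter_upwards [Metric.ball_mem_nhds 0 hδ] with x hx
    rw [← (hST x hx).2, map_smul, smul_smul, inv_mul_cancel₀ ht.ne', one_smul]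

/-! ### Eigenvectors modulo a subspace and formal eigenfunctions. -/

/-- Independence of eigenspaces, modulo the invariant subspace `N`. The operator `T - ν i₀` removes
`v i₀` from an expansion of `h` and multiplies `h` by `c - ν i₀ ≠ 0`, so unwanted eigenvectors are
eliminated one by one. -/
theorem mem_span_eigenvectors_sup {V : Type*} [AddCommGroup V] [Module ℂ V] {N : Submodule ℂ V}
    {T : V →ₗ[ℂ] V} (hN : N ≤ N.comap T) {ι : Type*} {v : ι → V} {ν : ι → ℂ}
    (hv : ∀ i, T (v i) - ν i • v i ∈ N) {h : V} {c : ℂ} (hh : T h - c • h ∈ N)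
    (hmem : h ∈ Submodule.span ℂ (range v) ⊔ N) :
    h ∈ Submodule.span ℂ (v '' {i | ν i = c}) ⊔ N := by
  classical
  set G := Submodule.span ℂ (v '' {i | ν i = c}) ⊔ N with hG
  have hNG : N ≤ G := le_sup_right
  have key : ∀ s : Finset ι, (∀ i ∈ s, ν i ≠ c) → h ∈ Submodule.span ℂ (v '' s) ⊔ G → h ∈ G := by
    intro s
    induction s using Finset.induction_on with
    | empty => simp
    | insert i₀ s _ ih =>
      intro hs hmem
      refine ih (fun i hi => hs i (Finset.mem_insert_of_mem hi)) ?_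
      set M := Submodule.span ℂ (v '' s) ⊔ G with hM
      have hNM : N ≤ M := hNG.trans le_sup_right
      let D : V →ₗ[ℂ] V := T - ν i₀ • LinearMap.id
      have hD : ∀ x, D x = T x - ν i₀ • x := fun x => by simp [D]
      have hle : Submodule.span ℂ (v '' (insert i₀ s : Finset ι)) ⊔ G ≤
          M.comap D := by
        have hgen : ∀ i, v i ∈ M → v i ∈ M.comap D := by
          intro i hi
          have : D (v i) =
              (T (v i) - ν i • v i) + (ν i - ν i₀) • v i := by
            rw [hD, sub_smul]; abel
          rw [Submodule.mem_comap, this]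
          exact M.add_mem (hNM (hv i)) (M.smul_mem _ hi)
        refine sup_le (Submodule.span_le.2 ?_) (sup_le (Submodule.span_le.2 ?_) ?_)
        · rintro _ ⟨i, hi, rfl⟩
          rcases Finset.mem_insert.1 (Finset.mem_coe.1 hi) with rfl | hi
          · rw [SetLike.mem_coe, Submodule.mem_comap, hD]
            exact hNM (hv _)
          · exact hgen i (Submodule.mem_sup_left (Submodule.subset_span ⟨i, hi, rfl⟩))
        · rintro _ ⟨i, hi, rfl⟩
          exact hgen i ((le_sup_left.trans le_sup_right :
            Submodule.span ℂ (v '' {i | ν i = c}) ≤ M) (Submodule.subset_span ⟨i, hi, rfl⟩))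
        · intro x hx
          rw [Submodule.mem_comap, hD]
          exact M.sub_mem (hNM (hN hx)) (M.smul_mem _ (hNM hx))
      have h1 : D h ∈ M := hle hmem
      have h2 : (c - ν i₀) • h ∈ M := by
        have : (c - ν i₀) • h = D h - (T h - c • h) := by
          rw [hD, sub_smul]; abel
        rw [this]
        exact M.sub_mem h1 (hNM hh)
      have h3 : c - ν i₀ ≠ 0 := sub_ne_zero.2 (hs i₀ (Finset.mem_insert_self _ _)).symm
      exact (M.smul_mem_iff h3).1 h2
  obtain ⟨p, hp, r, hr, rfl⟩ := Submodule.mem_sup.1 hmem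
  obtain ⟨a, rfl⟩ := (Finsupp.mem_span_range_iff_exists_finsupp).1 hp
  refine key (a.support.filter fun i => ν i ≠ c) (by simp) ?_
  refine Submodule.add_mem _ ?_ (Submodule.mem_sup_right (hNG hr))
  refine Submodule.sum_mem _ fun i hi => Submodule.smul_mem _ _ ?_
  by_cases hi' : ν i = c
  · exact Submodule.mem_sup_right (Submodule.mem_sup_left
      (Submodule.subset_span ⟨i, hi', rfl⟩))
  · exact Submodule.mem_sup_left
      (Submodule.subset_span ⟨i, by simp [hi', Finsupp.mem_support_iff.1 hi], rfl⟩)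

section Formal

variable {E : Type*} [NormedAddCommGroup E] [NormedSpace ℝ E] [FiniteDimensional ℝ E] {n : ℕ}
  {u : Fin n → E → ℂ} {f : E → E} {lam : Fin n → ℂ}

theorem IsCoordinateSystem.monomialFun_comp (hu : IsCoordinateSystem u) (hf : ContDiffAt ℝ ∞ f 0)
    (hf0 : f 0 = 0) (hlam : ∀ j, VanishesToOrder 2 (fun x => u j (f x) - lam j * u j x))
    {k : ℕ} {i : Fin n → ℕ} (hi : ∑ j, i j = k) :
    VanishesToOrder (k + 1)
      (fun x => monomialFun u i (f x) - multiPow lam i * monomialFun u i x) := by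
  induction k generalizing i with
  | zero =>
    have : i = 0 := by
      ext j
      simpa using (Finset.sum_eq_zero_iff.1 hi) j (Finset.mem_univ j)
    subst this
    simpa [monomialFun, multiPow] using VanishesToOrder.zero (E := E) (0 + 1)
  | succ k ih =>
    obtain ⟨l, i', rfl, h⟩ := exists_eq_add_single hi
    have hul := VanishesToOrder.one_iff.2 ⟨hu.contDiffAt l, hu.map_zero l⟩
    have h1 := (hlam l).mul ((hu.vanishesToOrder_monomialFun h).comp hf hf0)
    have h2 := (hul.const_mul (lam l)).mul (ih h)
    rw [show 2 + k = k + 1 + 1 by ring] at h1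
    rw [show 1 + (k + 1) = k + 1 + 1 by ring] at h2
    refine (h1.add h2).congr (Eventually.of_forall fun x => ?_)
    simp only [monomialFun, multiPow_add_single]
    ring

/-- The homological equation: to leading order `q ↦ q ∘ f - c q` acts on the monomial `u^[i]` as
multiplication by `λ^[i] - c`, which can be inverted. -/
theorem IsCoordinateSystem.exists_solve_homogeneous (hu : IsCoordinateSystem u)
    (hf : ContDiffAt ℝ ∞ f 0) (hf0 : f 0 = 0)
    (hlam : ∀ j, VanishesToOrder 2 (fun x => u j (f x) - lam j * u j x)) {c : ℂ} {k : ℕ}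
    (hc : ∀ i : Fin n → ℕ, ∑ j, i j = k → c ≠ multiPow lam i) {g : E → ℂ}
    (hg : g ∈ homogeneousSpan u k) :
    ∃ q : E → ℂ, VanishesToOrder k q ∧ VanishesToOrder (k + 1) (fun x => q (f x) - c * q x - g x) := by
  induction hg using Submodule.span_induction with
  | mem g hg =>
    obtain ⟨i, hi, rfl⟩ := hg
    have hne : multiPow lam i - c ≠ 0 := sub_ne_zero.2 (hc i hi).symm
    refine ⟨fun x => (multiPow lam i - c)⁻¹ * monomialFun u i x,
      (hu.vanishesToOrder_monomialFun hi).const_mul _, ?_⟩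
    refine ((hu.monomialFun_comp hf hf0 hlam hi).const_mul (multiPow lam i - c)⁻¹).congr
      (Eventually.of_forall fun x => ?_)
    field_simp
    ring
  | zero => exact ⟨fun _ => 0, VanishesToOrder.zero k, by simpa using VanishesToOrder.zero (k + 1)⟩
  | add g₁ g₂ _ _ h₁ h₂ =>
    obtain ⟨q₁, a₁, b₁⟩ := h₁
    obtain ⟨q₂, a₂, b₂⟩ := h₂
    refine ⟨_, a₁.add a₂, (b₁.add b₂).congr (Eventually.of_forall fun x => ?_)⟩
    simp only [Pi.add_apply]
    ring
  | smul a g _ h =>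
    obtain ⟨q, h₁, h₂⟩ := h
    refine ⟨_, h₁.const_mul a, (h₂.const_mul a).congr (Eventually.of_forall fun x => ?_)⟩
    simp only [Pi.smul_apply, smul_eq_mul]
    ring

theorem IsCoordinateSystem.exists_formal_eigenfunction (hu : IsCoordinateSystem u)
    (hf : ContDiffAt ℝ ∞ f 0) (hf0 : f 0 = 0)
    (hlam : ∀ j, VanishesToOrder 2 (fun x => u j (f x) - lam j * u j x)) (j : Fin n)
    (hres : ∀ i : Fin n → ℕ, 2 ≤ ∑ l, i l → lam j ≠ multiPow lam i) {k : ℕ} (hk : 2 ≤ k) :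
    ∃ p : E → ℂ, VanishesToOrder 2 (fun x => p x - u j x) ∧
      VanishesToOrder k (fun x => p (f x) - lam j * p x) := by
  induction k, hk using Nat.le_induction with
  | base => exact ⟨u j, by simpa using VanishesToOrder.zero 2, hlam j⟩
  | succ k hk ih =>
    obtain ⟨p, hp, hpk⟩ := ih
    obtain ⟨g, hg, hgk⟩ := hu.exists_leading hpk
    obtain ⟨q, hq, hqk⟩ := hu.exists_solve_homogeneous hf hf0 hlam
      (fun i hi => hres i (hi ▸ hk)) hg
    refine ⟨fun x => p x - q x, ?_, ?_⟩
    · exact (hp.sub (hq.mono hk)).congr (Eventually.of_forall fun x => by ring)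
    · exact (hgk.sub hqk).congr (Eventually.of_forall fun x => by ring)

end Formal

/-! ### Global eigenfunctions from a local contraction. -/

/-- The coordinate maps `κ : Q → E` and `σ : E → Q`, inverse to each other near `x₀` and `0`,
represent `F : Q → Q` near its globally attracting fixed point `x₀` by the smooth contraction
`f : E → E`. -/
structure IsLocalModel {Q E : Type*} [TopologicalSpace Q] [NormedAddCommGroup E] [NormedSpace ℝ E]
    (F : Q → Q) (x₀ : Q) (κ : Q → E) (σ : E → Q) (f : E → E) (ρ : ℝ) : Prop where
  contDiffAt : ContDiffAt ℝ ∞ f 0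
  map_zero : f 0 = 0
  norm_fderiv_lt : ‖fderiv ℝ f 0‖ < ρ
  lt_one : ρ < 1
  tendsto_chart : Tendsto κ (𝓝 x₀) (𝓝 0)
  symm_chart : ∀ᶠ x in 𝓝 x₀, σ (κ x) = x
  chart_symm : ∀ᶠ y in 𝓝 0, κ (σ y) = y
  semiconj : ∀ᶠ y in 𝓝 0, F (σ y) = σ (f y)
  attracting : ∀ x, Tendsto (fun m : ℕ => F^[m] x) atTop (𝓝 x₀)

theorem map_iterate_of_semiconj {X : Type*} {F : X → X} {g : X → ℂ} {c : ℂ}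
    (h : ∀ x, g (F x) = c * g x) (m : ℕ) (x : X) : g (F^[m] x) = c ^ m * g x := by
  induction m with
  | zero => simp
  | succ m ih => rw [Function.iterate_succ_apply', h, ih, pow_succ']; ring

theorem monomialFun_map {X : Type*} {F : X → X} {n : ℕ} {ψ : Fin n → X → ℂ} {lam : Fin n → ℂ}
    (hψ : ∀ j x, ψ j (F x) = lam j * ψ j x) (i : Fin n → ℕ) (x : X) :
    monomialFun ψ i (F x) = multiPow lam i * monomialFun ψ i x := by
  simp only [monomialFun, multiPow, hψ, mul_pow, Finset.prod_mul_distrib]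

theorem exists_pow_mul_lt_one {ρ : ℝ} (h0 : 0 ≤ ρ) (h1 : ρ < 1) (a : ℝ) :
    ∃ k : ℕ, 2 ≤ k ∧ ρ ^ k * a < 1 := by
  have h := (tendsto_pow_atTop_nhds_zero_of_lt_one h0 h1).mul_const a
  rw [zero_mul] at h
  obtain ⟨k, hk⟩ := ((h.eventually (gt_mem_nhds one_pos)).and (eventually_ge_atTop 2)).exists
  exact ⟨k, hk.2, hk.1⟩

namespace IsLocalModel

variable {Q E : Type*} [TopologicalSpace Q] [NormedAddCommGroup E] [NormedSpace ℝ E]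
  {F : Q → Q} {x₀ : Q} {κ : Q → E} {σ : E → Q} {f : E → E} {ρ : ℝ}

theorem nonneg (h : IsLocalModel F x₀ κ σ f ρ) : 0 ≤ ρ :=
  (norm_nonneg _).trans h.norm_fderiv_lt.le

/-- Arbitrarily small balls in which `f` contracts and represents all iterates of `F`. -/
theorem exists_ball (h : IsLocalModel F x₀ κ σ f ρ) {P : E → Prop} (hP : ∀ᶠ y in 𝓝 0, P y) :
    ∃ δ > 0, (∀ y ∈ Metric.ball (0 : E) δ, P y) ∧
      ∀ y ∈ Metric.ball (0 : E) δ, ∀ m, f^[m] y ∈ Metric.ball (0 : E) δ ∧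
        ‖f^[m] y‖ ≤ ρ ^ m * ‖y‖ ∧ F^[m] (σ y) = σ (f^[m] y) ∧ κ (σ (f^[m] y)) = f^[m] y := by
  obtain ⟨δ, hδ, hb⟩ := Metric.eventually_nhds_iff_ball.1 (hP.and ((h.chart_symm.and h.semiconj).and
    (eventually_norm_le_of_norm_fderiv_lt (h.contDiffAt.differentiableAt (by simp)) h.map_zero
      h.norm_fderiv_lt)))
  refine ⟨δ, hδ, fun y hy => (hb y hy).1, fun y hy => ?_⟩
  have h1 := fun m => norm_iterate_le h.nonneg h.lt_one.le (fun x hx => (hb x hx).2.2) hy m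
  have h2 : ∀ m, f^[m] y ∈ Metric.ball (0 : E) δ := fun m => by
    rw [mem_ball_zero_iff] at hy ⊢
    exact ((h1 m).trans (mul_le_of_le_one_left (norm_nonneg _)
      (pow_le_one₀ h.nonneg h.lt_one.le))).trans_lt hy
  refine fun m => ⟨h2 m, h1 m, ?_, (hb _ (h2 m)).2.1.1⟩
  induction m with
  | zero => rfl
  | succ m ih =>
    rw [Function.iterate_succ_apply', ih, (hb _ (h2 m)).2.1.2, Function.iterate_succ_apply']

theorem exists_iterate_mem (h : IsLocalModel F x₀ κ σ f ρ) {δ : ℝ} (hδ : 0 < δ) (x : Q) :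
    ∃ M : ℕ, ∃ y ∈ Metric.ball (0 : E) δ, F^[M] x = σ y := by
  have h1 := (h.symm_chart.and (h.tendsto_chart.eventually (Metric.ball_mem_nhds 0 hδ)))
  obtain ⟨M, hM⟩ := ((h.attracting x).eventually h1).exists
  exact ⟨M, κ (F^[M] x), hM.2, hM.1.symm⟩

variable [FiniteDimensional ℝ E]

theorem eq_zero_of_vanishesToOrder (h : IsLocalModel F x₀ κ σ f ρ) {g : Q → ℂ} {c : ℂ}
    (hc : c ≠ 0) (hg : ∀ x, g (F x) = c * g x) {k : ℕ} (hk : ρ ^ k * ‖c⁻¹‖ < 1)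
    (hgk : VanishesToOrder k (fun y => g (σ y))) (x : Q) : g x = 0 := by
  obtain ⟨C, hC0, hC⟩ := hgk.isBigO.exists_pos
  obtain ⟨δ, hδ, hb, hball⟩ := h.exists_ball hC.bound
  obtain ⟨M, y, hy, hM⟩ := h.exists_iterate_mem hδ x
  have key : ∀ m : ℕ, ‖g (σ y)‖ ≤ (ρ ^ k * ‖c⁻¹‖) ^ m * (C * ‖y‖ ^ k) := by
    intro m
    obtain ⟨h1, h2, h3, -⟩ := hball y hy m
    have h4 := hb _ h1
    rw [← h3, map_iterate_of_semiconj hg, norm_mul, norm_pow, norm_pow, norm_norm] at h4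
    have hc' : 0 < ‖c‖ := norm_pos_iff.2 hc
    have h5 : ‖c‖ ^ m * ‖g (σ y)‖ ≤ C * (ρ ^ m * ‖y‖) ^ k := h4.trans (by gcongr)
    calc ‖g (σ y)‖ = (‖c‖⁻¹) ^ m * (‖c‖ ^ m * ‖g (σ y)‖) := by
          rw [← mul_assoc, ← mul_pow, inv_mul_cancel₀ hc'.ne', one_pow, one_mul]
      _ ≤ (‖c‖⁻¹) ^ m * (C * (ρ ^ m * ‖y‖) ^ k) := by gcongr
      _ = _ := by rw [norm_inv]; ring
  have hlim : Tendsto (fun m : ℕ => (ρ ^ k * ‖c⁻¹‖) ^ m * (C * ‖y‖ ^ k)) atTop (𝓝 0) := by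
    have := h.nonneg
    simpa using (tendsto_pow_atTop_nhds_zero_of_lt_one (by positivity) hk).mul_const (C * ‖y‖ ^ k)
  have h0 : g (σ y) = 0 := norm_le_zero_iff.1 (ge_of_tendsto' hlim key)
  rw [← hM, map_iterate_of_semiconj hg] at h0
  exact (mul_eq_zero.1 h0).resolve_left (pow_ne_zero _ hc)

/-- The solution is the limit of `c⁻ᵐ p(κ(Fᵐ x))`. Near `x₀` it equals `p + c⁻¹ S`, and `S` inherits
a vanishing 1-jet from the remainder `R`; the limit at other points exists because their orbits
enter the ball. -/
theorem exists_eigenfunction (h : IsLocalModel F x₀ κ σ f ρ) {p : E → ℂ} {c : ℂ} (hc : c ≠ 0)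
    {k : ℕ} (hk2 : 2 ≤ k) (hk : ρ ^ k * ‖c⁻¹‖ < 1) 
    (hpk : VanishesToOrder k (fun y => p (f y) - c * p y)) :
    ∃ ψ : Q → ℂ, (∀ x, ψ (F x) = c * ψ x) ∧ VanishesToOrder 2 (fun y => ψ (σ y) - p y) := by
  set R : E → ℂ := fun y => p (f y) - c * p y with hR
  set S : E → ℂ := fun y => ∑' m : ℕ, c⁻¹ ^ m * R (f^[m] y) with hS
  obtain ⟨δ', hδ', hsum⟩ := exists_ball_hasFDerivAt_tsum h.contDiffAt h.map_zero h.norm_fderiv_lt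
    h.lt_one (by omega) hk hpk
  have hSsmooth : ContDiffAt ℝ ∞ S 0 := contDiffAt_infty.2 fun r =>
    contDiffAt_tsum_iterate r h.contDiffAt h.map_zero h.norm_fderiv_lt
      h.lt_one (by omega) hk hpk
  have hRk := hpk.mono hk2
  have hS2 : VanishesToOrder 2 S := by
    refine VanishesToOrder.two_of hSsmooth ?_ ?_
    · have : ∀ m, f^[m] 0 = 0 := fun m => Function.iterate_fixed h.map_zero m
      simp only [hS, this, (hRk.2.1 : R 0 = 0), mul_zero, tsum_zero]
    · obtain ⟨-, S', hS', hv⟩ := hsum 0 (Metric.mem_ball_self hδ')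
      rw [hS'.fderiv]
      ext v
      have hfst : ∀ m, ((tangentStep f)^[m] (0, v)).1 = 0 := by
        intro m
        induction m with
        | zero => rfl
        | succ m ih => rw [Function.iterate_succ_apply']; simp [tangentStep, ih, h.map_zero]
      rw [hv]
      simp only [hfst, hRk.fderiv_eq_zero, zero_apply, mul_zero, tsum_zero]
  obtain ⟨δ, hδ, hb, hball⟩ := h.exists_ball (P := fun y => y ∈ Metric.ball (0 : E) δ')
    (Metric.ball_mem_nhds 0 hδ')
  -- Telescoping with `p ∘ f = c p + R` turns the limit into partial sums of `S`.
  have hpart : ∀ (y : E) (m : ℕ), c⁻¹ ^ m * p (f^[m] y) =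
      p y + c⁻¹ * ∑ i ∈ Finset.range m, c⁻¹ ^ i * R (f^[i] y) := by
    intro y m
    induction m with
    | zero => simp
    | succ m ih =>
      rw [Finset.sum_range_succ, mul_add, ← add_assoc, ← ih, hR]
      simp only [Function.iterate_succ_apply', pow_succ]
      field_simp
      ring
  have hlim : ∀ y ∈ Metric.ball (0 : E) δ,
      Tendsto (fun m : ℕ => c⁻¹ ^ m * p (κ (F^[m] (σ y)))) atTop (𝓝 (p y + c⁻¹ * S y)) := by
    intro y hy
    have h1 := ((hsum y (hb y hy)).1.hasSum.tendsto_sum_nat.const_mul c⁻¹).const_add (p y)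
    refine h1.congr fun m => ?_
    obtain ⟨-, -, h3, h4⟩ := hball y hy m
    rw [h3, h4, hpart]
  have hlim' : ∀ x, ∃ z, Tendsto (fun m : ℕ => c⁻¹ ^ m * p (κ (F^[m] x))) atTop (𝓝 z) := by
    intro x
    obtain ⟨M, y, hy, hM⟩ := h.exists_iterate_mem hδ x
    refine ⟨c⁻¹ ^ M * (p y + c⁻¹ * S y), ?_⟩
    -- Shifting by the entry time `M` reduces the limit at `x` to the limit at a point of the ball.
    rw [← tendsto_add_atTop_iff_nat M]
    refine ((hlim y hy).const_mul (c⁻¹ ^ M)).congr fun m => ?_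
    rw [← hM, ← Function.iterate_add_apply, pow_add]
    ring
  choose ψ hψ using hlim'
  refine ⟨ψ, fun x => ?_, ?_⟩
  · have h1 := ((hψ x).comp (tendsto_add_atTop_nat 1)).const_mul c
    refine tendsto_nhds_unique (hψ (F x)) (h1.congr fun m => ?_)
    simp only [Function.comp_apply, Function.iterate_succ_apply, pow_succ]
    field_simp
  · refine (hS2.const_mul c⁻¹).congr ?_
    filter_upwards [Metric.ball_mem_nhds 0 hδ] with y hy
    rw [tendsto_nhds_unique (hψ (σ y)) (hlim y hy)]
    ring

variable {n : ℕ} {ψ : Fin n → Q → ℂ} {lam : Fin n → ℂ}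

/-- Expand `φ` to an order `k` at which uniqueness holds, keep only monomials with factor `c`, and
lift the resulting polynomial from the chart to `Q`. Being an exact eigenfunction there, it differs
from `φ` by one vanishing to order `k`, hence by zero. -/
theorem mem_span_monomialFun (h : IsLocalModel F x₀ κ σ f ρ)
    (hψ : ∀ j x, ψ j (F x) = lam j * ψ j x) (hu : IsCoordinateSystem fun j y => ψ j (σ y))
    {φ : Q → ℂ} {c : ℂ} (hc : c ≠ 0) (hφ : ∀ x, φ (F x) = c * φ x)
    (hsm : ContDiffAt ℝ ∞ (fun y => φ (σ y)) 0) :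
    φ ∈ Submodule.span ℂ (monomialFun ψ '' {i | multiPow lam i = c}) := by
  obtain ⟨k, -, hk⟩ := exists_pow_mul_lt_one h.nonneg h.lt_one ‖c⁻¹‖
  have hN : vanishingSubmodule E k ≤ (vanishingSubmodule E k).comap (LinearMap.funLeft ℂ ℂ f) :=
    fun g hg => VanishesToOrder.comp hg h.contDiffAt h.map_zero
  have hmem := mem_span_eigenvectors_sup hN
    (v := monomialFun fun j y => ψ j (σ y)) (ν := multiPow lam) (h := fun y => φ (σ y)) (c := c)
    (fun i => (VanishesToOrder.zero k).congr (by
      filter_upwards [h.semiconj] with y hy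
      have := monomialFun_map hψ i (σ y)
      rw [hy] at this
      exact (sub_eq_zero.2 this).symm))
    ((VanishesToOrder.zero k).congr (by
      filter_upwards [h.semiconj] with y hy
      have := hφ (σ y)
      rw [hy] at this
      exact (sub_eq_zero.2 this).symm))
    (hu.mem_span_sup hsm k)
  obtain ⟨p, hp, r, hr, hpr⟩ := Submodule.mem_sup.1 hmem
  have himg : (monomialFun fun j y => ψ j (σ y)) '' {i | multiPow lam i = c} =
      (LinearMap.funLeft ℂ ℂ σ) '' (monomialFun ψ '' {i | multiPow lam i = c}) := by
    rw [image_image]; rfl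
  rw [himg, ← Submodule.map_span] at hp
  obtain ⟨P, hP, rfl⟩ := hp
  have hPF : ∀ x, P (F x) = c * P x := by
    intro x
    have : Submodule.span ℂ (monomialFun ψ '' {i | multiPow lam i = c}) ≤
        LinearMap.ker (LinearMap.funLeft ℂ ℂ F - c • LinearMap.id) := by
      refine Submodule.span_le.2 ?_
      rintro _ ⟨i, rfl, rfl⟩
      rw [SetLike.mem_coe, LinearMap.mem_ker]
      ext x
      exact sub_eq_zero.2 (monomialFun_map hψ i x)
    have h1 := congrFun (LinearMap.mem_ker.1 (this hP)) x
    exact sub_eq_zero.1 h1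
  have hzero : φ = P := by
    ext x
    refine sub_eq_zero.1 (h.eq_zero_of_vanishesToOrder (g := fun x => φ x - P x) hc
      (fun x => ?_) hk ?_ x)
    · rw [hφ, hPF, mul_sub]
    · refine (hr : VanishesToOrder k r).congr (Eventually.of_forall fun y => ?_)
      have := congrFun hpr y
      exact eq_sub_of_add_eq' this
  rwa [hzero]

theorem exists_finsupp (h : IsLocalModel F x₀ κ σ f ρ)
    (hψ : ∀ j x, ψ j (F x) = lam j * ψ j x) (hu : IsCoordinateSystem fun j y => ψ j (σ y))
    {φ : Q → ℂ} {c : ℂ} (hc : c ≠ 0) (hφ : ∀ x, φ (F x) = c * φ x)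
    (hsm : ContDiffAt ℝ ∞ (fun y => φ (σ y)) 0) :
    ∃ a : (Fin n → ℕ) →₀ ℂ, ∀ x, φ x = ∑ i ∈ a.support, a i * multiPow (fun j => ψ j x) i := by
  have h1 := Submodule.span_mono (image_subset_range _ _) (h.mem_span_monomialFun hψ hu hc hφ hsm)
  obtain ⟨a, rfl⟩ := Finsupp.mem_span_range_iff_exists_finsupp.1 h1
  refine ⟨a, fun x => ?_⟩
  simp [Finsupp.sum, monomialFun]

/-- Nonresonance leaves only monomials of degree one in the expansion, so `φ` is a linear
combination of the `ψ_l`; its zero differential and the independence of the `dψ_l` make all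
coefficients vanish. -/
theorem eq_zero_of_nonresonant (h : IsLocalModel F x₀ κ σ f ρ)
    (hψ : ∀ j x, ψ j (F x) = lam j * ψ j x) (hu : IsCoordinateSystem fun j y => ψ j (σ y))
    (hind : LinearIndependent ℂ fun j => fderiv ℝ (fun y => ψ j (σ y)) 0)
    (hres : ∀ j, ∀ i : Fin n → ℕ, 2 ≤ ∑ l, i l → lam j ≠ multiPow lam i) {j : Fin n}
    (hj : lam j ≠ 0) {φ : Q → ℂ} (hφ : ∀ x, φ (F x) = lam j * φ x)
    (hφ2 : VanishesToOrder 2 (fun y => φ (σ y))) (x : Q) : φ x = 0 := by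
  have h1 := h.mem_span_monomialFun hψ hu hj hφ hφ2.contDiffAt
  have h2 : φ ∈ Submodule.span ℂ (range ψ) := by
    refine Submodule.span_mono ?_ h1
    rintro _ ⟨i, hi, rfl⟩
    have hi2 : ∑ l, i l < 2 := by
      by_contra hcon
      exact hres j i (not_lt.1 hcon) (Eq.symm hi)
    -- A constant term would need `λ_j = 1`, which is itself a resonance, `1 = 1 ^ 2`.
    have hi0 : ∑ l, i l ≠ 0 := by
      intro h0
      have : i = 0 := by
        ext l; simpa using (Finset.sum_eq_zero_iff.1 h0) l (Finset.mem_univ l)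
      subst this
      have hone : lam j = 1 := by simpa [multiPow] using Eq.symm hi
      refine hres j (Pi.single j 2) (by simp) ?_
      rw [multiPow, Finset.prod_eq_single j] <;> simp +contextual [hone]
    obtain ⟨l, i', rfl, hi'⟩ := exists_eq_add_single (k := 0) (i := i) (by omega)
    have : i' = 0 := by
      ext l; simpa using (Finset.sum_eq_zero_iff.1 hi') l (Finset.mem_univ l)
    subst this
    refine ⟨l, ?_⟩
    ext x
    simpa [monomialFun, multiPow] using (multiPow_add_single (fun j => ψ j x) 0 l).symm
  obtain ⟨a, rfl⟩ := (Submodule.mem_span_range_iff_exists_fun ℂ).1 h2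
  have h3 : HasFDerivAt (fun y => (∑ l, a l • ψ l) (σ y))
      (∑ l, a l • fderiv ℝ (fun y => ψ l (σ y)) 0) 0 := by
    have := HasFDerivAt.fun_sum (u := Finset.univ) fun (l : Fin n) _ =>
      (((hu.contDiffAt l).differentiableAt (by simp)).hasFDerivAt).const_mul (a l)
    simpa [Finset.sum_apply] using this
  have h4 := hφ2.fderiv_eq_zero
  rw [h3.fderiv] at h4
  have h5 := Fintype.linearIndependent_iff.1 hind a h4
  simp [h5]

end IsLocalModel

/-! ### Diagonalization on the complexified dual space. -/

/-- The hypothesis says that generalized eigenvectors of rank two are eigenvectors, so by induction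
all generalized eigenvectors are, and these span over `ℂ`. This form of semisimplicity can be
verified directly for the generator of a flow. -/
theorem exists_eigenbasis {W : Type*} [AddCommGroup W] [Module ℂ W] [FiniteDimensional ℂ W]
    {n : ℕ} (hn : Module.finrank ℂ W = n) (T : Module.End ℂ W)
    (hT : ∀ μ : ℂ, ∀ w, T (T w - μ • w) = μ • (T w - μ • w) → T w = μ • w) :
    ∃ (b : Module.Basis (Fin n) ℂ W) (lam : Fin n → ℂ), ∀ j, T (b j) = lam j • b j := by
  have hgen : ∀ μ : ℂ, ∀ k : ℕ, ∀ w, ((T - algebraMap ℂ (Module.End ℂ W) μ) ^ k) w = 0 →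
      T w = μ • w := by
    intro μ k
    have happ : ∀ w, (T - algebraMap ℂ (Module.End ℂ W) μ) w = T w - μ • w := fun w => by simp
    induction k with
    | zero => intro w hw; simp at hw; simp [hw]
    | succ k ih =>
      intro w hw
      refine hT μ w (ih _ ?_)
      rw [pow_succ, Module.End.mul_apply, happ] at hw
      exact hw
  let s : Set W := {w | ∃ μ : ℂ, T w = μ • w}
  have hs : ⊤ ≤ Submodule.span ℂ s := by
    rw [← Module.End.iSup_maxGenEigenspace_eq_top T]
    refine iSup_le fun μ w hw => Submodule.subset_span ⟨μ, ?_⟩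
    obtain ⟨k, hk⟩ := (Module.End.mem_maxGenEigenspace T μ w).1 hw
    exact hgen μ k w (by simpa [Algebra.algebraMap_eq_smul_one] using hk)
  let b₀ := Module.Basis.ofSpan hs
  have hfin : Finite (((linearIndepOn_empty ℂ id).extend (empty_subset s) : Set W)) :=
    Module.Finite.finite_basis b₀
  have := Fintype.ofFinite (((linearIndepOn_empty ℂ id).extend (empty_subset s) : Set W))
  let b := b₀.reindex (Fintype.equivFinOfCardEq
    ((Module.finrank_eq_card_basis b₀).symm.trans hn))
  have hb : ∀ j, ∃ μ : ℂ, T (b j) = μ • b j := by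
    intro j
    have : b j ∈ range b₀ := by simp [b]
    exact Module.Basis.ofSpan_subset hs this
  choose lam hlam using hb
  exact ⟨b, lam, hlam⟩

section Precomposition

variable {V : Type*} [AddCommGroup V] [Module ℝ V]

/-- Precomposition with a real endomorphism, acting on the complexified dual space. -/
noncomputable def precomp (A : Module.End ℝ V) : Module.End ℂ (V →ₗ[ℝ] ℂ) where
  toFun w := w ∘ₗ A
  map_add' _ _ := rfl
  map_smul' _ _ := rfl

theorem precomp_apply (A : Module.End ℝ V) (w : V →ₗ[ℝ] ℂ) (x : V) : precomp A w x = w (A x) := rfl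

theorem aeval_precomp (A : Module.End ℝ V) (p : Polynomial ℝ) (w : V →ₗ[ℝ] ℂ) :
    Polynomial.aeval (precomp A) (p.map (algebraMap ℝ ℂ)) w = w ∘ₗ Polynomial.aeval A p := by
  induction p using Polynomial.induction_on' with
  | add p q hp hq =>
    rw [Polynomial.map_add, map_add, LinearMap.add_apply, hp, hq, map_add, LinearMap.comp_add]
  | monomial k a =>
    have hpow : ∀ w : V →ₗ[ℝ] ℂ, (precomp A ^ k) w = w ∘ₗ (A ^ k) := by
      induction k with
      | zero => intro w; rfl
      | succ k ih =>
        intro w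
        rw [pow_succ, Module.End.mul_apply, ih, pow_succ']
        rfl
    ext x
    simp [Polynomial.aeval_monomial, hpow]

/-- The real minimal polynomial is squarefree, hence separable, hence still squarefree over `ℂ`, and
it annihilates the dual action. -/
theorem isSemisimple_precomp [FiniteDimensional ℝ V] {A : Module.End ℝ V}
    (hA : A.IsSemisimple) : (precomp A).IsSemisimple := by
  refine Module.End.isSemisimple_of_squarefree_aeval_eq_zero
    (p := (minpoly ℝ A).map (algebraMap ℝ ℂ)) ?_ ?_
  · exact ((PerfectField.separable_iff_squarefree.2 hA.minpoly_squarefree).map).squarefree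
  · ext w x
    rw [aeval_precomp, minpoly.aeval]
    simp

theorem precomp_eq_smul_of_isSemisimple [FiniteDimensional ℝ V] {A : Module.End ℝ V}
    (hA : A.IsSemisimple) (μ : ℂ) (w : V →ₗ[ℝ] ℂ)
    (hw : precomp A (precomp A w - μ • w) = μ • (precomp A w - μ • w)) :
    precomp A w = μ • w := by
  have h1 := (isSemisimple_precomp hA).isFinitelySemisimple.genEigenspace_eq_eigenspace μ
    (k := 2) (by norm_num)
  have h2 : w ∈ (precomp A).genEigenspace μ 2 := by
    rw [show (2 : ℕ∞) = ((2 : ℕ) : ℕ∞) from rfl, Module.End.mem_genEigenspace_nat, LinearMap.mem_ker, pow_two, Module.End.mul_apply]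
    simpa [sub_eq_zero] using hw
  rw [h1] at h2
  exact Module.End.mem_eigenspace_iff.1 h2

variable [FiniteDimensional ℝ V] {n : ℕ} {A : Module.End ℝ V} {lam : Fin n → ℂ}

theorem finrank_eq_of_basis (b : Module.Basis (Fin n) ℂ (V →ₗ[ℝ] ℂ)) :
    Module.finrank ℝ V = n := by
  have h1 := Module.finrank_eq_card_basis b
  rw [Module.finrank_linearMap] at h1
  simpa using h1

/-- Evaluation against the dual eigenbasis identifies the complexification with `ℂⁿ`. It is
injective because every complex functional on the complexification extends a real-linear map `V →
ℂ`. -/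
theorem exists_diagonalization (b : Module.Basis (Fin n) ℂ (V →ₗ[ℝ] ℂ))
    (hb : ∀ j, precomp A (b j) = lam j • b j) :
    ∃ e : TensorProduct ℝ ℂ V ≃ₗ[ℂ] (Fin n → ℂ),
      e.conj (A.baseChange ℂ) = Matrix.toLin' (Matrix.diagonal lam) := by
  let W : TensorProduct ℝ ℂ V →ₗ[ℂ] (Fin n → ℂ) := LinearMap.pi fun j => (b j).liftBaseChange ℂ
  have hinj : Function.Injective W := by
    refine (injective_iff_map_eq_zero W).2 fun z hz => ?_
    refine (Module.forall_dual_apply_eq_zero_iff ℂ z).1 fun g => ?_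
    obtain ⟨w, rfl⟩ := (LinearMap.liftBaseChangeEquiv (R := ℝ) (M := V) (N := ℂ) ℂ).surjective g
    rw [← b.sum_repr w, map_sum, LinearMap.sum_apply]
    refine Finset.sum_eq_zero fun j _ => ?_
    rw [map_smul, LinearMap.smul_apply]
    have : (b j).liftBaseChange ℂ z = 0 := congrFun hz j
    exact smul_eq_zero_of_right _ this
  let e := W.linearEquivOfInjective hinj (by
    rw [Module.finrank_baseChange, finrank_eq_of_basis b]; simp)
  refine ⟨e, ?_⟩
  have key : ∀ z, e (A.baseChange ℂ z) = fun j => lam j * e z j := by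
    intro z
    induction z using TensorProduct.induction_on with
    | zero => ext j; simp
    | add x y hx hy => ext j; simp [hx, hy, mul_add]
    | tmul c x =>
      ext j
      have h1 : b j (A x) = lam j * b j x := congrArg (fun w : V →ₗ[ℝ] ℂ => w x) (hb j)
      simp [e, W, h1]
      ring
  refine LinearMap.ext fun z => ?_
  rw [LinearEquiv.conj_apply_apply, key]
  ext j
  simp [Matrix.mulVec_diagonal]

theorem roots_charpoly_baseChange (b : Module.Basis (Fin n) ℂ (V →ₗ[ℝ] ℂ))
    (hb : ∀ j, precomp A (b j) = lam j • b j) :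
    (A.baseChange ℂ).charpoly.roots = Multiset.map lam Finset.univ.val := by
  obtain ⟨e, he⟩ := exists_diagonalization b hb
  rw [← LinearEquiv.charpoly_conj e, he, Matrix.charpoly_toLin', Matrix.charpoly_diagonal]
  have : ∏ j, (Polynomial.X - Polynomial.C (lam j)) =
      ((Multiset.map lam Finset.univ.val).map fun a => Polynomial.X - Polynomial.C a).prod := by
    rw [Multiset.map_map]; rfl
  rw [this, Polynomial.roots_multiset_prod_X_sub_C]

theorem hasEigenvalue_baseChange (b : Module.Basis (Fin n) ℂ (V →ₗ[ℝ] ℂ))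
    (hb : ∀ j, precomp A (b j) = lam j • b j) (j : Fin n) :
    Module.End.HasEigenvalue (A.baseChange ℂ) (lam j) := by
  obtain ⟨e, he⟩ := exists_diagonalization b hb
  refine Module.End.hasEigenvalue_of_hasEigenvector (x := e.symm (Pi.single j 1))
    ⟨Module.End.mem_eigenspace_iff.2 ?_, by simp⟩
  apply e.injective
  have := LinearMap.congr_fun he (Pi.single j 1)
  rw [LinearEquiv.conj_apply_apply] at this
  rw [this]
  ext l
  by_cases hl : l = j
  · subst hl; simp
  · simp [hl]

/-- Here `lam` is recognized as an enumeration of the eigenvalues with multiplicity; the reindexing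
only accounts for `finrank` being equal to `n` propositionally. -/
theorem nonresonant_of_baseChange (b : Module.Basis (Fin n) ℂ (V →ₗ[ℝ] ℂ))
    (hb : ∀ j, precomp A (b j) = lam j • b j)
    (hA : IsInftyNonresonant (A.baseChange ℂ) (A.baseChange ℂ)) (j : Fin n) (i : Fin n → ℕ)
    (hi : 2 ≤ ∑ l, i l) : lam j ≠ multiPow lam i := by
  have hn : Module.finrank ℂ (TensorProduct ℝ ℂ V) = n := by
    rw [Module.finrank_baseChange, finrank_eq_of_basis b]
  have h := hA (∑ l, i l) (by omega) (lam ∘ finCongr hn) ?_ (lam j)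
    (hasEigenvalue_baseChange b hb j) (i ∘ finCongr hn) ?_ ?_
  · exact fun h' => h (h'.trans (Equiv.prod_comp (finCongr hn) fun l => lam l ^ i l).symm)
  · rw [roots_charpoly_baseChange b hb]
    rw [← Multiset.map_map, Multiset.map_univ_val_equiv]
  · exact hi.trans (Equiv.sum_comp (finCongr hn) i).ge
  · exact (Equiv.sum_comp (finCongr hn) i).le

end Precomposition

/-! ### Stability puts the spectrum inside the unit disc. -/

section Linear

variable {V : Type*} [NormedAddCommGroup V] [NormedSpace ℝ V] {n : ℕ}

/-- The coordinates of a vector with respect to a basis of the complexified dual space. -/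
noncomputable def dualCoords (b : Module.Basis (Fin n) ℂ (V →ₗ[ℝ] ℂ)) : V →ₗ[ℝ] (Fin n → ℂ) :=
  LinearMap.pi fun j => b j

theorem dualCoords_injective (b : Module.Basis (Fin n) ℂ (V →ₗ[ℝ] ℂ)) :
    Function.Injective (dualCoords b) := by
  refine (injective_iff_map_eq_zero (dualCoords b)).2 fun x hx => ?_
  refine (Module.forall_dual_apply_eq_zero_iff ℝ x).1 fun g => ?_
  have h1 : ∀ w : V →ₗ[ℝ] ℂ, w x = 0 := by
    intro w
    rw [← b.sum_repr w, LinearMap.sum_apply]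
    refine Finset.sum_eq_zero fun j _ => ?_
    have : b j x = 0 := congrFun hx j
    rw [LinearMap.smul_apply, this, smul_zero]
  have h2 := h1 (Complex.ofRealCLM.toLinearMap ∘ₗ g)
  simpa using h2

theorem dual_eigen_apply {b : Module.Basis (Fin n) ℂ (V →ₗ[ℝ] ℂ)} {lam : Fin n → ℂ}
    {A : V →L[ℝ] V} (hb : ∀ j, precomp A.toLinearMap (b j) = lam j • b j) (j : Fin n) (x : V) :
    b j (A x) = lam j * b j x := congrArg (fun w : V →ₗ[ℝ] ℂ => w x) (hb j)

/-- A cone argument. If some `|λ_j| > 1`, split the eigencoordinates into expanding ones `U` and the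
remaining ones `S`. Near `0` the cone `‖S x‖ ≤ ‖U x‖` is preserved by `f`, which increases `‖U x‖`
by a fixed factor, so orbits in the cone cannot remain small. -/
theorem norm_lt_one_of_stable [FiniteDimensional ℝ V] (b : Module.Basis (Fin n) ℂ (V →ₗ[ℝ] ℂ))
    {lam : Fin n → ℂ} {A : V →L[ℝ] V} (hb : ∀ j, precomp A.toLinearMap (b j) = lam j • b j)
    (hne : ∀ j, ‖lam j‖ ≠ 1) {f : V → V} (hf : HasFDerivAt f A 0) (hf0 : f 0 = 0)
    (hstab : ∀ ε > 0, ∃ δ > 0, ∀ y, ‖y‖ < δ → ∀ m : ℕ, ‖f^[m] y‖ < ε) (j : Fin n) :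
    ‖lam j‖ < 1 := by
  by_contra hj
  replace hj : 1 < ‖lam j‖ := lt_of_le_of_ne (not_lt.1 hj) (hne j).symm
  obtain ⟨κ, hκ1, hκ⟩ : ∃ κ : ℝ, 1 < κ ∧ ∀ l, 1 < ‖lam l‖ → κ ≤ ‖lam l‖ := by
    obtain ⟨l, hl, hmin⟩ := Finset.exists_min_image (Finset.univ.filter fun l => 1 < ‖lam l‖)
      (fun l => ‖lam l‖) ⟨j, by simpa using hj⟩
    exact ⟨‖lam l‖, by simpa using hl, fun l' hl' => hmin l' (by simpa using hl')⟩
  let U : V →L[ℝ] (Fin n → ℂ) := LinearMap.toContinuousLinearMap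
    (LinearMap.pi fun l => if 1 < ‖lam l‖ then b l else 0)
  let S : V →L[ℝ] (Fin n → ℂ) := LinearMap.toContinuousLinearMap
    (LinearMap.pi fun l => if 1 < ‖lam l‖ then 0 else b l)
  have hU : ∀ x l, U x l = if 1 < ‖lam l‖ then b l x else 0 := by
    intro x l
    by_cases h : 1 < ‖lam l‖ <;> simp [U, h]
  have hS : ∀ x l, S x l = if 1 < ‖lam l‖ then 0 else b l x := by
    intro x l
    by_cases h : 1 < ‖lam l‖ <;> simp [S, h]
  have hUA : ∀ x, κ * ‖U x‖ ≤ ‖U (A x)‖ := by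
    intro x
    rw [← le_div_iff₀' (by linarith)]
    refine (pi_norm_le_iff_of_nonneg (by positivity)).2 fun l => ?_
    rw [le_div_iff₀' (by linarith)]
    refine le_trans ?_ (norm_le_pi_norm (U (A x)) l)
    rw [hU, hU]
    split_ifs with h
    · rw [dual_eigen_apply hb, norm_mul]
      gcongr
      exact hκ l h
    · simp
  have hSA : ∀ x, ‖S (A x)‖ ≤ ‖S x‖ := by
    intro x
    refine (pi_norm_le_iff_of_nonneg (norm_nonneg _)).2 fun l => ?_
    refine le_trans ?_ (norm_le_pi_norm (S x) l)
    rw [hS, hS]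
    split_ifs with h
    · simp
    · rw [dual_eigen_apply hb, norm_mul]
      exact mul_le_of_le_one_left (norm_nonneg _) (not_lt.1 h)
  -- Inside the cone `U` alone controls the full norm, since all eigencoordinates together are
  -- injective. Errors `o(‖x‖)` thus become small multiples of `‖U x‖`.
  obtain ⟨C, hC0, hC⟩ : ∃ C : ℝ, 0 < C ∧ ∀ x, ‖S x‖ ≤ ‖U x‖ → ‖x‖ ≤ C * ‖U x‖ := by
    obtain ⟨C, hC0, hC⟩ := (LinearMap.toContinuousLinearMap (dualCoords b)).exists_antilipschitzWith
      (LinearMap.ker_eq_bot.2 (dualCoords_injective b))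
    refine ⟨C, hC0, fun x hx => (ContinuousLinearMap.bound_of_antilipschitz _ hC x).trans ?_⟩
    gcongr
    refine (pi_norm_le_iff_of_nonneg (norm_nonneg _)).2 fun l => ?_
    change ‖b l x‖ ≤ _
    by_cases h : 1 < ‖lam l‖
    · have := norm_le_pi_norm (U x) l
      rwa [hU, if_pos h] at this
    · have := norm_le_pi_norm (S x) l
      rw [hS, if_neg h] at this
      exact this.trans hx
  set K := max ‖U‖ ‖S‖ + 1 with hK
  have hKpos : 0 < K := by positivity
  have hUK : ∀ x, ‖U x‖ ≤ K * ‖x‖ := fun x => (U.le_opNorm x).trans (by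
    gcongr; exact (le_max_left _ _).trans (le_add_of_nonneg_right zero_le_one))
  have hSK : ∀ x, ‖S x‖ ≤ K * ‖x‖ := fun x => (S.le_opNorm x).trans (by
    gcongr; exact (le_max_right _ _).trans (le_add_of_nonneg_right zero_le_one))
  -- With `κ = 1 + 4η` and an error of `η ‖U x‖` on each side, `‖U (f x)‖ ≥ (1 + 3η) ‖U x‖` while
  -- `‖S (f x)‖ ≤ (1 + η) ‖U x‖`, which gives both invariance and growth.
  set η := (κ - 1) / 4 with hη
  have hη0 : 0 < η := by rw [hη]; linarith
  obtain ⟨r, hr, hfr⟩ := Metric.eventually_nhds_iff_ball.1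
    (hf.isLittleO.bound (show 0 < η / (K * C) by positivity))
  have hstep : ∀ x, ‖x‖ < r → ‖S x‖ ≤ ‖U x‖ →
      ‖S (f x)‖ ≤ ‖U (f x)‖ ∧ (1 + η) * ‖U x‖ ≤ ‖U (f x)‖ := by
    intro x hx hcone
    have h1 := hfr x (by simpa using hx)
    simp only [hf0, sub_zero] at h1
    have h2 : K * ‖f x - A x‖ ≤ η * ‖U x‖ := by
      calc K * ‖f x - A x‖ ≤ K * (η / (K * C) * (C * ‖U x‖)) := by
            gcongr; exact h1.trans (by gcongr; exact hC x hcone)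
        _ = η * ‖U x‖ := by field_simp
    have h3 : ‖U (f x)‖ ≥ ‖U (A x)‖ - η * ‖U x‖ := by
      have h := norm_sub_norm_le (U (A x)) (U (A x) - U (f x))
      rw [sub_sub_cancel, ← map_sub, ← neg_sub (f x), map_neg, norm_neg] at h
      linarith [hUK (f x - A x)]
    have h4 : ‖S (f x)‖ ≤ ‖S (A x)‖ + η * ‖U x‖ := by
      have h := norm_add_le (S (A x)) (S (f x - A x))
      rw [← map_add, add_sub_cancel] at h
      linarith [hSK (f x - A x)]
    have h5 := hUA x
    have h6 := hSA x
    have h7 : κ = 1 + 4 * η := by rw [hη]; ring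
    rw [h7] at h5
    have h8 := mul_nonneg hη0.le (norm_nonneg (U x))
    constructor <;> nlinarith
  -- A real vector of the cone is found by iterating `A` on one with `b j x ≠ 0`: the `U` part grows
  -- geometrically and the `S` part stays bounded.
  obtain ⟨x, hxU, hxS⟩ : ∃ x, U x ≠ 0 ∧ ‖S x‖ ≤ ‖U x‖ := by
    obtain ⟨x, hx⟩ : ∃ x, b j x ≠ 0 := by
      by_contra! h
      exact b.ne_zero j (LinearMap.ext h)
    have hUx : 0 < ‖U x‖ := by
      refine norm_pos_iff.2 fun h => hx ?_
      have := congrFun h j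
      rwa [hU, if_pos hj] at this
    have h1 : ∀ m : ℕ, κ ^ m * ‖U x‖ ≤ ‖U (A^[m] x)‖ ∧ ‖S (A^[m] x)‖ ≤ ‖S x‖ := by
      intro m
      induction m with
      | zero => simp
      | succ m ih =>
        rw [Function.iterate_succ_apply']
        refine ⟨?_, (hSA _).trans ih.2⟩
        calc κ ^ (m + 1) * ‖U x‖ = κ * (κ ^ m * ‖U x‖) := by ring
          _ ≤ κ * ‖U (A^[m] x)‖ := by gcongr; exact ih.1
          _ ≤ _ := hUA _
    obtain ⟨m, hm⟩ := pow_unbounded_of_one_lt (‖S x‖ / ‖U x‖) hκ1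
    rw [div_lt_iff₀ hUx] at hm
    refine ⟨A^[m] x, norm_pos_iff.1 ?_, (h1 m).2.trans (hm.le.trans (h1 m).1)⟩
    exact lt_of_lt_of_le (by positivity) (h1 m).1
  obtain ⟨δ, hδ, hδr⟩ := hstab r hr
  obtain ⟨t, ht, htx⟩ : ∃ t : ℝ, 0 < t ∧ ‖t • x‖ < δ := by
    refine ⟨δ / (‖x‖ + 1), by positivity, ?_⟩
    rw [norm_smul, Real.norm_of_nonneg (by positivity), div_mul_eq_mul_div,
      div_lt_iff₀ (by positivity)]
    nlinarith [norm_nonneg x]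
  have hUy : 0 < ‖U (t • x)‖ := by
    rw [map_smul, norm_smul]
    exact mul_pos (norm_pos_iff.2 ht.ne') (norm_pos_iff.2 hxU)
  have hSy : ‖S (t • x)‖ ≤ ‖U (t • x)‖ := by
    rw [map_smul, map_smul, norm_smul, norm_smul]
    gcongr
  have hgrow : ∀ m : ℕ, ‖S (f^[m] (t • x))‖ ≤ ‖U (f^[m] (t • x))‖ ∧
      (1 + η) ^ m * ‖U (t • x)‖ ≤ ‖U (f^[m] (t • x))‖ := by
    intro m
    induction m with
    | zero => simpa using hSy
    | succ m ih =>
      rw [Function.iterate_succ_apply']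
      obtain ⟨h1, h2⟩ := hstep _ (hδr _ htx m) ih.1
      refine ⟨h1, ?_⟩
      calc (1 + η) ^ (m + 1) * ‖U (t • x)‖ = (1 + η) * ((1 + η) ^ m * ‖U (t • x)‖) := by ring
        _ ≤ (1 + η) * ‖U (f^[m] (t • x))‖ := by gcongr; exact ih.2
        _ ≤ _ := h2
  obtain ⟨m, hm⟩ := pow_unbounded_of_one_lt (K * r / ‖U (t • x)‖) (show 1 < 1 + η by linarith)
  rw [div_lt_iff₀ hUy] at hm
  have h1 := (hgrow m).2
  have h2 := hUK (f^[m] (t • x))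
  have h3 : K * ‖f^[m] (t • x)‖ ≤ K * r := by gcongr; exact (hδr _ htx m).le
  linarith

end Linear

/-! ### Eigenfunctions from a centered chart. -/

theorem IsCoordinateSystem.of_sub {E : Type*} [NormedAddCommGroup E] [NormedSpace ℝ E] {n : ℕ}
    {u v : Fin n → E → ℂ} (hu : IsCoordinateSystem u)
    (huv : ∀ j, VanishesToOrder 2 (fun y => v j y - u j y)) :
    IsCoordinateSystem v ∧ ∀ j, fderiv ℝ (v j) 0 = fderiv ℝ (u j) 0 := by
  have hv : ∀ j, v j = fun y => (v j y - u j y) + u j y := fun j => by ext y; ring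
  have hsm : ∀ j, ContDiffAt ℝ ∞ (v j) 0 := fun j => by
    rw [hv]; exact (huv j).contDiffAt.add (hu.contDiffAt j)
  have hd : ∀ j, fderiv ℝ (v j) 0 = fderiv ℝ (u j) 0 := fun j => by
    have h1 := (huv j).fderiv_eq_zero
    have h2 := fderiv_fun_sub ((hsm j).differentiableAt (by simp))
      ((hu.contDiffAt j).differentiableAt (by simp))
    rw [h1] at h2
    exact sub_eq_zero.1 h2.symm
  refine ⟨⟨hsm, fun j => ?_, fun ξ => ?_⟩, hd⟩
  · have := (huv j).2.1
    simpa [hu.map_zero] using this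
  · simp only [hd]
    exact hu.exists_sum ξ

/-- `κ` is a chart sending `x₀` to `0`, and `σ` is its inverse, both extended by junk values. -/
structure IsCenteredChart {Q V : Type*} [TopologicalSpace Q] [NormedAddCommGroup V]
    (x₀ : Q) (κ : Q → V) (σ : V → Q) : Prop where
  map_base : κ x₀ = 0
  continuousAt : ContinuousAt κ x₀
  tendsto_symm : Tendsto σ (𝓝 0) (𝓝 x₀)
  symm_chart : ∀ᶠ x in 𝓝 x₀, σ (κ x) = x
  chart_symm : ∀ᶠ y in 𝓝 0, κ (σ y) = y

theorem IsCenteredChart.symm_zero {Q V : Type*} [TopologicalSpace Q] [NormedAddCommGroup V]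
    {x₀ : Q} {κ : Q → V} {σ : V → Q} (h : IsCenteredChart x₀ κ σ) : σ 0 = x₀ :=
  h.map_base ▸ h.symm_chart.self_of_nhds

/-- The isomorphism `e` transports the chart to a norm in which the derivative has operator norm at
most `ρ₀ < 1`, giving an `IsLocalModel`. The coordinate system is the eigenbasis `b` read through
`e`, and the conclusions are pulled back to `V`. -/
theorem exists_eigenfunctions_of_adapted_norm {Q V : Type*} [TopologicalSpace Q] [NormedAddCommGroup V]
    [NormedSpace ℝ V] {E : Type*} [NormedAddCommGroup E] [NormedSpace ℝ E]
    [FiniteDimensional ℝ E] {n : ℕ} {F : Q → Q} {x₀ : Q} {κ : Q → V} {σ : V → Q}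
    (hF : ContinuousAt F x₀) (hFx₀ : F x₀ = x₀) (hchart : IsCenteredChart x₀ κ σ)
    (hattr : ∀ x, Tendsto (fun m : ℕ => F^[m] x) atTop (𝓝 x₀))
    (hf : ContDiffAt ℝ ∞ (fun y => κ (F (σ y))) 0) {A : V →L[ℝ] V}
    (hA : HasFDerivAt (fun y => κ (F (σ y))) A 0)
    (b : Module.Basis (Fin n) ℂ (V →ₗ[ℝ] ℂ)) {lam : Fin n → ℂ}
    (hb : ∀ j, precomp A.toLinearMap (b j) = lam j • b j) (b' : Fin n → V →L[ℝ] ℂ)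
    (hb' : ∀ j y, b' j y = b j y) (e : V ≃L[ℝ] E) {ρ₀ : ℝ}
    (hρ₀0 : 0 ≤ ρ₀) (hρ₀1 : ρ₀ < 1) (he : ∀ y, ‖e (A y)‖ ≤ ρ₀ * ‖e y‖)
    (hlam0 : ∀ j, lam j ≠ 0)
    (hres : ∀ j, ∀ i : Fin n → ℕ, 2 ≤ ∑ l, i l → lam j ≠ multiPow lam i) :
    ∃ ψ : Fin n → Q → ℂ, (∀ j x, ψ j (F x) = lam j * ψ j x) ∧
      (∀ j, ContDiffAt ℝ ∞ (fun y => ψ j (σ y)) 0) ∧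
      (∀ j, ψ j x₀ = 0) ∧
      (∀ j, HasFDerivAt (fun y => ψ j (σ y)) (b' j) 0) ∧
      (∀ (φ : Q → ℂ) (c : ℂ), c ≠ 0 → (∀ x, φ (F x) = c * φ x) →
        ContDiffAt ℝ ∞ (fun y => φ (σ y)) 0 →
        ∃ a : (Fin n → ℕ) →₀ ℂ, ∀ x, φ x = ∑ i ∈ a.support, a i * multiPow (fun j => ψ j x) i) ∧
      ∀ (φ : Q → ℂ) (j : Fin n), (∀ x, φ (F x) = lam j * φ x) →
        VanishesToOrder 2 (fun y => φ (σ y)) → ∀ x, φ x = 0 := by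
  have : FiniteDimensional ℝ V := e.symm.toLinearEquiv.finiteDimensional
  have hσ0 : σ 0 = x₀ := hchart.symm_zero
  obtain ⟨hκ0, hκ, hσ, hσκ, hκσ⟩ := hchart
  let f : E → E := fun z => e (κ (F (σ (e.symm z))))
  have hesymm : Tendsto e.symm (𝓝 0) (𝓝 0) := by
    have := e.symm.continuous.tendsto 0
    rwa [map_zero] at this
  have hfsm : ContDiffAt ℝ ∞ f 0 := by
    refine e.contDiff.contDiffAt.comp (0 : E) ?_
    refine ContDiffAt.comp (0 : E) (g := fun y => κ (F (σ y))) ?_ e.symm.contDiff.contDiffAt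
    rwa [map_zero]
  have hf0 : f 0 = 0 := by simp only [f, map_zero, hσ0, hFx₀, hκ0]
  have hfd : HasFDerivAt f (e.toContinuousLinearMap ∘L A ∘L e.symm.toContinuousLinearMap) 0 := by
    refine e.hasFDerivAt.comp (0 : E) ?_
    refine HasFDerivAt.comp (0 : E) (g := fun y => κ (F (σ y))) ?_ e.symm.hasFDerivAt
    rwa [map_zero]
  have hnorm : ‖fderiv ℝ f 0‖ ≤ ρ₀ := by
    rw [hfd.fderiv]
    refine ContinuousLinearMap.opNorm_le_bound _ hρ₀0 fun z => ?_
    obtain ⟨y, rfl⟩ := e.surjective z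
    simp only [ContinuousLinearMap.comp_apply, ContinuousLinearEquiv.coe_coe,
      ContinuousLinearEquiv.symm_apply_apply]
    exact he y
  obtain ⟨ρ, hρ, hρ1⟩ := exists_between hρ₀1
  have hFσ : Tendsto (fun z => F (σ (e.symm z))) (𝓝 0) (𝓝 x₀) := by
    have h1 : Tendsto F (𝓝 x₀) (𝓝 x₀) := by simpa [ContinuousAt, hFx₀] using hF
    exact h1.comp (hσ.comp hesymm)
  have hmodel : IsLocalModel F x₀ (fun x => e (κ x)) (fun z => σ (e.symm z)) f ρ :=
    { contDiffAt := hfsm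
      map_zero := hf0
      norm_fderiv_lt := hnorm.trans_lt hρ
      lt_one := hρ1
      tendsto_chart := by
        have h1 : ContinuousAt (fun x => e (κ x)) x₀ := e.continuous.continuousAt.comp hκ
        simpa [ContinuousAt, hκ0] using h1
      symm_chart := by simpa using hσκ
      chart_symm := by
        filter_upwards [hesymm.eventually hκσ] with z hz
        rw [hz, e.apply_symm_apply]
      semiconj := by
        filter_upwards [hFσ.eventually hσκ] with z hz
        simp only [f, e.symm_apply_apply, hz]
      attracting := hattr }
  let u' : Fin n → E →L[ℝ] ℂ := fun j => (b' j).comp e.symm.toContinuousLinearMap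
  have hu'e : ∀ j y, u' j (e y) = b j y := fun j y => by simp [u', hb']
  let u : Fin n → E → ℂ := fun j => u' j
  have hu' : ∀ j, fderiv ℝ (u j) 0 = u' j := fun j => (u' j).hasFDerivAt.fderiv
  have hu : IsCoordinateSystem u :=
    { contDiffAt := fun j => (u' j).contDiff.contDiffAt
      map_zero := fun j => (u' j).map_zero
      exists_sum := fun ξ => by
        refine ⟨fun j => b.repr (ξ.toLinearMap ∘ₗ e.toLinearEquiv.toLinearMap) j, ?_⟩
        ext z
        obtain ⟨y, rfl⟩ := e.surjective z
        have h1 := b.sum_repr (ξ.toLinearMap ∘ₗ e.toLinearEquiv.toLinearMap)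
        have h2 := congrArg (fun w : V →ₗ[ℝ] ℂ => w y) h1
        rw [LinearMap.sum_apply] at h2
        rw [sum_apply, ← show _ = ξ (e y) from h2]
        refine Finset.sum_congr rfl fun j _ => ?_
        rw [hu', LinearMap.smul_apply, smul_apply, hu'e] }
  have hulam : ∀ j, VanishesToOrder 2 (fun z => u j (f z) - lam j * u j z) := by
    intro j
    have h1 : HasFDerivAt (fun z => u j (f z) - lam j * u j z)
        ((u' j).comp (e.toContinuousLinearMap ∘L A ∘L e.symm.toContinuousLinearMap) -
          lam j • u' j) 0 :=
      ((u' j).hasFDerivAt.comp (0 : E) hfd).sub ((u' j).hasFDerivAt.const_mul (lam j))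
    refine VanishesToOrder.two_of ?_ ?_ ?_
    · exact ((u' j).contDiff.contDiffAt.comp (0 : E) hfsm).sub
        (contDiffAt_const.mul (u' j).contDiff.contDiffAt)
    · rw [hf0]
      simp [hu.map_zero]
    · rw [h1.fderiv]
      ext z
      obtain ⟨y, rfl⟩ := e.surjective z
      have h2 := dual_eigen_apply hb j y
      have h3 : u' j (e (A y)) = lam j * u' j (e y) := by rw [hu'e, hu'e, h2]
      simp [h3]
  have hex : ∀ j, ∃ ψ : Q → ℂ, (∀ x, ψ (F x) = lam j * ψ x) ∧
      VanishesToOrder 2 (fun z => ψ (σ (e.symm z)) - u j z) := by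
    intro j
    obtain ⟨k, hk2, hk⟩ := exists_pow_mul_lt_one hmodel.nonneg hρ1 ‖(lam j)⁻¹‖
    obtain ⟨p, hp, hpk⟩ := hu.exists_formal_eigenfunction hfsm hf0 hulam j (hres j) hk2
    obtain ⟨ψ, hψ, hψp⟩ := hmodel.exists_eigenfunction (hlam0 j) hk2 hk hpk
    exact ⟨ψ, hψ, (hψp.add hp).congr (Eventually.of_forall fun z => by ring)⟩
  choose ψ hψ hψu using hex
  obtain ⟨hv, hvd⟩ := hu.of_sub hψu
  have hback : ∀ g : Q → ℂ, (fun y => g (σ y)) = fun y => (fun z => g (σ (e.symm z))) (e y) := by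
    intro g; ext y; simp
  have hind : LinearIndependent ℂ fun j => fderiv ℝ (fun z => ψ j (σ (e.symm z))) 0 := by
    refine Fintype.linearIndependent_iff.2 fun a ha => ?_
    refine Fintype.linearIndependent_iff.1 b.linearIndependent a ?_
    ext y
    have h1 := congrArg (fun w : E →L[ℝ] ℂ => w (e y)) ha
    rw [sum_apply] at h1
    rw [LinearMap.sum_apply]
    refine (Finset.sum_congr rfl fun j _ => ?_).trans h1
    rw [hvd, hu', LinearMap.smul_apply, smul_apply, hu'e]
  refine ⟨ψ, hψ, fun j => ?_, fun j => ?_, fun j => ?_, fun φ c hc hφ hsm => ?_,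
    fun φ j hφ hφ2 => ?_⟩
  · rw [hback]
    refine ContDiffAt.comp (0 : V) (g := fun z => ψ j (σ (e.symm z))) ?_ e.contDiff.contDiffAt
    rw [map_zero]
    exact hv.contDiffAt j
  · have h1 := hv.map_zero j
    simpa [hσ0] using h1
  · rw [hback]
    have h1 : HasFDerivAt (fun z => ψ j (σ (e.symm z))) (u' j) (e 0) := by
      rw [map_zero, ← hu' j, ← hvd j]
      exact ((hv.contDiffAt j).differentiableAt (by simp)).hasFDerivAt
    have h2 : b' j = (u' j).comp e.toContinuousLinearMap := by ext y; simp [u']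
    rw [h2]
    exact h1.comp (0 : V) e.hasFDerivAt
  · refine hmodel.exists_finsupp hψ hv hc hφ ?_
    refine ContDiffAt.comp (0 : E) (g := fun y => φ (σ y)) ?_ e.symm.contDiff.contDiffAt
    rwa [map_zero]
  · exact hmodel.eq_zero_of_nonresonant hψ hv hind hres (hlam0 j) hφ
      (hφ2.comp e.symm.contDiff.contDiffAt (map_zero _))

/-- The adapted norm is the sup norm of the eigencoordinates: `V` is replaced by its image in `ℂⁿ`,
where `A` multiplies the `j`-th coordinate by `λ_j` and so contracts by `max |λ_j| < 1`. -/
theorem exists_eigenfunctions_of_chart {Q V : Type*} [TopologicalSpace Q] [NormedAddCommGroup V]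
    [NormedSpace ℝ V] [FiniteDimensional ℝ V] {n : ℕ} {F : Q → Q} {x₀ : Q} {κ : Q → V} {σ : V → Q}
    (hF : ContinuousAt F x₀) (hFx₀ : F x₀ = x₀) (hchart : IsCenteredChart x₀ κ σ)
    (hattr : ∀ x, Tendsto (fun m : ℕ => F^[m] x) atTop (𝓝 x₀))
    (hf : ContDiffAt ℝ ∞ (fun y => κ (F (σ y))) 0) {A : V →L[ℝ] V}
    (hA : HasFDerivAt (fun y => κ (F (σ y))) A 0)
    (b : Module.Basis (Fin n) ℂ (V →ₗ[ℝ] ℂ)) {lam : Fin n → ℂ}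
    (hb : ∀ j, precomp A.toLinearMap (b j) = lam j • b j) (hlam : ∀ j, ‖lam j‖ < 1)
    (hlam0 : ∀ j, lam j ≠ 0)
    (hres : ∀ j, ∀ i : Fin n → ℕ, 2 ≤ ∑ l, i l → lam j ≠ multiPow lam i) :
    ∃ ψ : Fin n → Q → ℂ, (∀ j x, ψ j (F x) = lam j * ψ j x) ∧
      (∀ j, ContDiffAt ℝ ∞ (fun y => ψ j (σ y)) 0) ∧
      (∀ j, ψ j x₀ = 0) ∧
      (∀ j, HasFDerivAt (fun y => ψ j (σ y)) (LinearMap.toContinuousLinearMap (b j)) 0) ∧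
      (∀ (φ : Q → ℂ) (c : ℂ), c ≠ 0 → (∀ x, φ (F x) = c * φ x) →
        ContDiffAt ℝ ∞ (fun y => φ (σ y)) 0 →
        ∃ a : (Fin n → ℕ) →₀ ℂ, ∀ x, φ x = ∑ i ∈ a.support, a i * multiPow (fun j => ψ j x) i) ∧
      ∀ (φ : Q → ℂ) (j : Fin n), (∀ x, φ (F x) = lam j * φ x) →
        VanishesToOrder 2 (fun y => φ (σ y)) → ∀ x, φ x = 0 := by
  let e : V ≃L[ℝ] LinearMap.range (dualCoords b) :=
    (LinearEquiv.ofInjective (dualCoords b) (dualCoords_injective b)).toContinuousLinearEquiv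
  refine exists_eigenfunctions_of_adapted_norm hF hFx₀ hchart hattr hf hA b hb
    (fun j => LinearMap.toContinuousLinearMap (b j)) (fun j y => rfl) e (ρ₀ := ‖lam‖)
    (norm_nonneg _) ((pi_norm_lt_iff one_pos).2 hlam) (fun y => ?_) hlam0 hres
  refine (pi_norm_le_iff_of_nonneg (by positivity)).2 fun j => ?_
  change ‖b j (A y)‖ ≤ _
  rw [dual_eigen_apply hb, norm_mul]
  exact mul_le_mul (norm_le_pi_norm lam j) (norm_le_pi_norm (e y : Fin n → ℂ) j)
    (norm_nonneg _) (norm_nonneg _)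

/-! ### The time-one map on the manifold. -/

section Manifold

variable {n : ℕ} {Q : Type*} [TopologicalSpace Q] [ChartedSpace (EuclideanSpace ℝ (Fin n)) Q]

/-- The preferred chart at `x₀`, translated so that `x₀` is sent to `0`. -/
noncomputable def centeredChart (x₀ x : Q) : EuclideanSpace ℝ (Fin n) :=
  extChartAt (𝓡 n) x₀ x - extChartAt (𝓡 n) x₀ x₀

/-- The inverse of `centeredChart`. -/
noncomputable def centeredChartSymm (x₀ : Q) (y : EuclideanSpace ℝ (Fin n)) : Q :=
  (extChartAt (𝓡 n) x₀).symm (y + extChartAt (𝓡 n) x₀ x₀)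

theorem isCenteredChart (x₀ : Q) :
    IsCenteredChart x₀ (centeredChart (n := n) x₀) (centeredChartSymm x₀) := by
  have hadd : Tendsto (fun y : EuclideanSpace ℝ (Fin n) => y + extChartAt (𝓡 n) x₀ x₀) (𝓝 0)
      (𝓝 (extChartAt (𝓡 n) x₀ x₀)) := by
    have : Continuous (fun y : EuclideanSpace ℝ (Fin n) => y + extChartAt (𝓡 n) x₀ x₀) := by fun_prop
    simpa using this.tendsto 0
  refine ⟨sub_self _, (continuousAt_extChartAt x₀).sub continuousAt_const, ?_, ?_, ?_⟩
  · have h := (continuousAt_extChartAt_symm (I := 𝓡 n) x₀).tendsto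
    rw [extChartAt_to_inv] at h
    exact h.comp hadd
  · filter_upwards [extChartAt_source_mem_nhds (I := 𝓡 n) x₀] with x hx
    simp only [centeredChart, centeredChartSymm, sub_add_cancel]
    exact (extChartAt (𝓡 n) x₀).left_inv hx
  · filter_upwards [hadd.eventually (extChartAt_target_mem_nhds (I := 𝓡 n) x₀)] with y hy
    simp only [centeredChart, centeredChartSymm]
    rw [(extChartAt (𝓡 n) x₀).right_inv hy, add_sub_cancel_right]

theorem contMDiffAt_centeredChart (x₀ : Q) :
    ContMDiffAt (𝓡 n) 𝓘(ℝ, EuclideanSpace ℝ (Fin n)) ∞ (centeredChart (n := n) x₀) x₀ := by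
  have h1 : ContMDiffAt (𝓡 n) 𝓘(ℝ, EuclideanSpace ℝ (Fin n)) ∞ (extChartAt (𝓡 n) x₀) x₀ :=
    contMDiffAt_extChartAt
  exact h1.sub contMDiffAt_const

theorem contMDiffAt_centeredChartSymm [IsManifold (𝓡 n) ∞ Q] (x₀ : Q) :
    ContMDiffAt 𝓘(ℝ, EuclideanSpace ℝ (Fin n)) (𝓡 n) ∞ (centeredChartSymm (n := n) x₀) 0 := by
  have h1 : ContMDiffAt 𝓘(ℝ, EuclideanSpace ℝ (Fin n)) (𝓡 n) ∞ (extChartAt (𝓡 n) x₀).symm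
      (0 + extChartAt (𝓡 n) x₀ x₀) := by
    rw [zero_add]
    exact (contMDiffOn_extChartAt_symm x₀).contMDiffAt (extChartAt_target_mem_nhds x₀)
  have h2 : ContDiff ℝ ∞ (fun y : EuclideanSpace ℝ (Fin n) => y + extChartAt (𝓡 n) x₀ x₀) := by
    fun_prop
  exact ContMDiffAt.comp (0 : EuclideanSpace ℝ (Fin n)) h1 h2.contMDiff.contMDiffAt

theorem contDiffAt_of_contMDiffAt [IsManifold (𝓡 n) ∞ Q] {x₀ : Q} {g : Q → ℂ}
    (hg : ContMDiffAt (𝓡 n) 𝓘(ℝ, ℂ) ∞ g x₀) :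
    ContDiffAt ℝ ∞ (fun y => g (centeredChartSymm (n := n) x₀ y)) 0 := by
  rw [← contMDiffAt_iff_contDiffAt]
  refine ContMDiffAt.comp (0 : EuclideanSpace ℝ (Fin n)) ?_ (contMDiffAt_centeredChartSymm x₀)
  rwa [(isCenteredChart x₀).symm_zero]

theorem contMDiffAt_of_contDiffAt [IsManifold (𝓡 n) ∞ Q] {x₀ : Q} {g : Q → ℂ}
    (hg : ContDiffAt ℝ ∞ (fun y => g (centeredChartSymm (n := n) x₀ y)) 0) :
    ContMDiffAt (𝓡 n) 𝓘(ℝ, ℂ) ∞ g x₀ := by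
  have h1 : ContMDiffAt (𝓡 n) 𝓘(ℝ, ℂ) ∞
      (fun x => g (centeredChartSymm (n := n) x₀ (centeredChart x₀ x))) x₀ := by
    refine ContMDiffAt.comp (g := fun y => g (centeredChartSymm (n := n) x₀ y)) x₀ ?_
      (contMDiffAt_centeredChart x₀)
    rw [(isCenteredChart (n := n) x₀).map_base]
    exact hg.contMDiffAt
  refine h1.congr_of_eventuallyEq ?_
  filter_upwards [(isCenteredChart (n := n) x₀).symm_chart] with x hx
  rw [hx]

theorem contDiffAt_chart_conj [IsManifold (𝓡 n) ∞ Q] {x₀ : Q} {F : Q → Q} (hF : ContMDiffAt (𝓡 n) (𝓡 n) ∞ F x₀)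
    (hFx₀ : F x₀ = x₀) :
    ContDiffAt ℝ ∞ (fun y => centeredChart (n := n) x₀ (F (centeredChartSymm (n := n) x₀ y))) 0 := by
  rw [← contMDiffAt_iff_contDiffAt]
  have h0 := (isCenteredChart (n := n) x₀).symm_zero
  have h1 : ContMDiffAt 𝓘(ℝ, EuclideanSpace ℝ (Fin n)) (𝓡 n) ∞
      (fun y => F (centeredChartSymm (n := n) x₀ y)) 0 :=
    ContMDiffAt.comp (0 : EuclideanSpace ℝ (Fin n)) (by rwa [h0])
      (contMDiffAt_centeredChartSymm x₀)
  have h2 : ContMDiffAt (𝓡 n) 𝓘(ℝ, EuclideanSpace ℝ (Fin n)) ∞ (centeredChart (n := n) x₀)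
      (F (centeredChartSymm (n := n) x₀ 0)) := by
    rw [h0, hFx₀]; exact contMDiffAt_centeredChart x₀
  exact ContMDiffAt.comp (g := centeredChart (n := n) x₀) (0 : EuclideanSpace ℝ (Fin n)) h2 h1

theorem hasFDerivAt_chart_conj {x₀ : Q} {F : Q → Q} (hF : ContMDiffAt (𝓡 n) (𝓡 n) ∞ F x₀)
    (hFx₀ : F x₀ = x₀) :
    HasFDerivAt (fun y => centeredChart (n := n) x₀ (F (centeredChartSymm (n := n) x₀ y)))
      (LinearMap.toContinuousLinearMap (derivAtFixed (n := n) F x₀)) 0 := by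
  obtain ⟨L, hL, h⟩ : ∃ L : EuclideanSpace ℝ (Fin n) →L[ℝ] EuclideanSpace ℝ (Fin n),
      LinearMap.toContinuousLinearMap (derivAtFixed (n := n) F x₀) = L ∧
      HasFDerivAt (writtenInExtChartAt (𝓡 n) (𝓡 n) x₀ F) L (extChartAt (𝓡 n) x₀ x₀) := by
    refine ⟨_, rfl, ?_⟩
    have h1 : HasFDerivWithinAt (writtenInExtChartAt (𝓡 n) (𝓡 n) x₀ F)
        (LinearMap.toContinuousLinearMap (derivAtFixed (n := n) F x₀)) (range (𝓡 n))
        (extChartAt (𝓡 n) x₀ x₀) := (hF.mdifferentiableAt (by simp)).hasMFDerivAt.2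
    rw [modelWithCornersSelf_coe, range_id, hasFDerivWithinAt_univ] at h1
    exact h1
  rw [hL]
  have h2 : HasFDerivAt (fun y : EuclideanSpace ℝ (Fin n) => y + extChartAt (𝓡 n) x₀ x₀)
      (ContinuousLinearMap.id ℝ _) 0 := (hasFDerivAt_id _).add_const _
  have h3 : HasFDerivAt (writtenInExtChartAt (𝓡 n) (𝓡 n) x₀ F) L
      ((fun y : EuclideanSpace ℝ (Fin n) => y + extChartAt (𝓡 n) x₀ x₀) 0) := by
    simpa using h
  have h4 := (h3.comp (0 : EuclideanSpace ℝ (Fin n)) h2).sub_const (extChartAt (𝓡 n) x₀ x₀)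
  simp only [writtenInExtChartAt, hFx₀, ContinuousLinearMap.comp_id] at h4
  exact h4

/-- Regularity at `x₀` spreads along orbits through `ψ = c⁻ᵐ ψ ∘ Fᵐ`. -/
theorem contMDiff_of_eigenfunction [IsManifold (𝓡 n) ∞ Q] {x₀ : Q} {F : Q → Q} (hF : ContMDiff (𝓡 n) (𝓡 n) ∞ F)
    (hattr : ∀ x, Tendsto (fun m : ℕ => F^[m] x) atTop (𝓝 x₀)) {ψ : Q → ℂ} {c : ℂ} (hc : c ≠ 0)
    (hψ : ∀ x, ψ (F x) = c * ψ x) (h0 : ContMDiffAt (𝓡 n) 𝓘(ℝ, ℂ) ∞ ψ x₀) :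
    ContMDiff (𝓡 n) 𝓘(ℝ, ℂ) ∞ ψ := by
  -- Being `C^∞` at a point gives, for each finite `r`, a neighbourhood of `C^r` points, but no
  -- common neighbourhood; hence `r` is fixed first and `m` depends on it.
  rw [contMDiff_infty]
  intro r x
  have h1 : ContMDiffAt (𝓡 n) 𝓘(ℝ, ℂ) r ψ x₀ := h0.of_le (by exact_mod_cast le_top)
  have : IsManifold (𝓡 n) r Q := IsManifold.of_le (n := ∞) (by exact_mod_cast le_top)
  obtain ⟨m, hm⟩ := ((hattr x).eventually ((contMDiffAt_iff_contMDiffAt_nhds (by simp)).1 h1)).exists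
  have hiter : ContMDiff (𝓡 n) (𝓡 n) r (F^[m]) := by
    have hF' : ContMDiff (𝓡 n) (𝓡 n) r F := hF.of_le (by exact_mod_cast le_top)
    clear hm
    induction m with
    | zero => exact contMDiff_id
    | succ m ih => exact ih.comp hF'
  have hmul : ContDiff ℝ r (fun z : ℂ => (c ^ m)⁻¹ * z) := contDiff_const.mul contDiff_id
  have h2 : ContMDiffAt (𝓡 n) 𝓘(ℝ, ℂ) r (fun x => (c ^ m)⁻¹ * ψ (F^[m] x)) x :=
    ContMDiffAt.comp x hmul.contMDiff.contMDiffAt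
      (ContMDiffAt.comp x (g := ψ) hm hiter.contMDiffAt)
  refine h2.congr_of_eventuallyEq (Eventually.of_forall fun y => ?_)
  have := pow_ne_zero m hc
  simp only [map_iterate_of_semiconj hψ]
  field_simp

theorem mfderiv_ne_zero_of_hasFDerivAt [IsManifold (𝓡 n) ∞ Q] {x₀ : Q} {ψ : Q → ℂ}
    (hψ : ContMDiffAt (𝓡 n) 𝓘(ℝ, ℂ) ∞ ψ x₀) {w : EuclideanSpace ℝ (Fin n) →L[ℝ] ℂ} (hw : w ≠ 0)
    (h : HasFDerivAt (fun y => ψ (centeredChartSymm (n := n) x₀ y)) w 0) :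
    mfderiv (𝓡 n) 𝓘(ℝ, ℂ) ψ x₀ ≠ 0 := by
  intro h0
  have hσ := (contMDiffAt_centeredChartSymm (n := n) x₀).mdifferentiableAt (by simp)
  have hs0 := (isCenteredChart (n := n) x₀).symm_zero
  have h1 : MDifferentiableAt (𝓡 n) 𝓘(ℝ, ℂ) ψ (centeredChartSymm (n := n) x₀ 0) := by
    rw [hs0]; exact hψ.mdifferentiableAt (by simp)
  have h2 := mfderiv_comp (0 : EuclideanSpace ℝ (Fin n)) h1 hσ
  have h3 : mfderiv (𝓡 n) 𝓘(ℝ, ℂ) ψ (centeredChartSymm (n := n) x₀ 0) = 0 := by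
    rw [hs0]; exact h0
  rw [h3, mfderiv_eq_fderiv] at h2
  refine hw (h.fderiv.symm.trans (h2.trans ?_))
  ext v
  rfl

/-- Iterates of the chart representative follow those of `F` only while the orbit stays where the
chart is inverted by `σ`, so that region is included in the neighbourhood to which stability is
applied. -/
theorem norm_iterate_chart_lt {x₀ : Q} {F : Q → Q}
    (hstab : ∀ U ∈ 𝓝 x₀, ∃ V ∈ 𝓝 x₀, ∀ x ∈ V, ∀ m : ℕ, F^[m] x ∈ U) (ε : ℝ) (hε : 0 < ε) :
    ∃ δ > 0, ∀ y : EuclideanSpace ℝ (Fin n), ‖y‖ < δ → ∀ m : ℕ,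
      ‖(fun y => centeredChart (n := n) x₀ (F (centeredChartSymm (n := n) x₀ y)))^[m] y‖ < ε := by
  have hch := isCenteredChart (n := n) x₀
  have hκ : Tendsto (centeredChart (n := n) x₀) (𝓝 x₀) (𝓝 0) := by
    simpa [ContinuousAt, hch.map_base] using hch.continuousAt
  obtain ⟨V, hV, hVU⟩ := hstab _ (hch.symm_chart.and (hκ.eventually (Metric.ball_mem_nhds 0 hε)))
  obtain ⟨δ, hδ, hb⟩ := Metric.eventually_nhds_iff_ball.1
    ((hch.tendsto_symm.eventually hV).and hch.chart_symm)
  refine ⟨δ, hδ, fun y hy => ?_⟩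
  obtain ⟨h1, h2⟩ := hb y (by simpa using hy)
  have h3 : ∀ m : ℕ, (fun y => centeredChart (n := n) x₀ (F (centeredChartSymm (n := n) x₀ y)))^[m] y =
      centeredChart x₀ (F^[m] (centeredChartSymm x₀ y)) := by
    intro m
    induction m with
    | zero => exact h2.symm
    | succ m ih =>
      rw [Function.iterate_succ_apply', ih, (hVU _ h1 m).1, Function.iterate_succ_apply']
  intro m
  rw [h3]
  simpa using (hVU _ h1 m).2

theorem exists_smooth_eigenfunctions [IsManifold (𝓡 n) ∞ Q] {x₀ : Q} {F : Q → Q} (hF : ContMDiff (𝓡 n) (𝓡 n) ∞ F)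
    (hFx₀ : F x₀ = x₀) (hattr : ∀ x, Tendsto (fun m : ℕ => F^[m] x) atTop (𝓝 x₀))
    (hstab : ∀ U ∈ 𝓝 x₀, ∃ V ∈ 𝓝 x₀, ∀ x ∈ V, ∀ m : ℕ, F^[m] x ∈ U)
    (hhyp : ∀ z : ℂ, (complexify (derivAtFixed (n := n) F x₀)).HasEigenvalue z → ‖z‖ ≠ 1)
    (hA : IsInftyNonresonant (complexify (derivAtFixed (n := n) F x₀))
      (complexify (derivAtFixed (n := n) F x₀)))
    (b : Module.Basis (Fin n) ℂ (EuclideanSpace ℝ (Fin n) →ₗ[ℝ] ℂ)) {lam : Fin n → ℂ}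
    (hb : ∀ j, precomp (derivAtFixed (n := n) F x₀) (b j) = lam j • b j) :
    ∃ ψ : Fin n → Q → ℂ, (∀ j, lam j ≠ 0) ∧ (∀ j x, ψ j (F x) = lam j * ψ j x) ∧
      (∀ j, ContMDiff (𝓡 n) 𝓘(ℝ, ℂ) ∞ (ψ j)) ∧
      (∀ j, ψ j x₀ = 0) ∧
      (∀ j, HasFDerivAt (fun y => ψ j (centeredChartSymm (n := n) x₀ y))
        (LinearMap.toContinuousLinearMap (b j)) 0) ∧
      (∀ (φ : Q → ℂ) (c : ℂ), c ≠ 0 → (∀ x, φ (F x) = c * φ x) →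
        ContMDiff (𝓡 n) 𝓘(ℝ, ℂ) ∞ φ →
        ∃ a : (Fin n → ℕ) →₀ ℂ, ∀ x, φ x = ∑ i ∈ a.support, a i * multiPow (fun j => ψ j x) i) ∧
      ∀ (φ : Q → ℂ) (j : Fin n), (∀ x, φ (F x) = lam j * φ x) →
        ContMDiff (𝓡 n) 𝓘(ℝ, ℂ) ∞ φ → φ x₀ = 0 →
        HasFDerivAt (fun y => φ (centeredChartSymm (n := n) x₀ y))
          (0 : EuclideanSpace ℝ (Fin n) →L[ℝ] ℂ) 0 → ∀ x, φ x = 0 := by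
  have hres := nonresonant_of_baseChange b hb hA
  have hne : ∀ j, ‖lam j‖ ≠ 1 := fun j => hhyp _ (hasEigenvalue_baseChange b hb j)
  -- A zero eigenvalue would be resonant: `0 = 0 ^ 2`.
  have hlam0 : ∀ j, lam j ≠ 0 := by
    intro j h0
    refine hres j (Pi.single j 2) (by simp) ?_
    rw [multiPow, Finset.prod_eq_single j] <;> simp +contextual [h0]
  have hd := hasFDerivAt_chart_conj hF.contMDiffAt hFx₀
  have hch := isCenteredChart (n := n) x₀
  have hf0 : centeredChart (n := n) x₀ (F (centeredChartSymm (n := n) x₀ 0)) = 0 := by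
    rw [hch.symm_zero, hFx₀, hch.map_base]
  have hlt := norm_lt_one_of_stable b hb hne hd hf0 (norm_iterate_chart_lt hstab)
  obtain ⟨ψ, h1, h2, h3, h4, h5, h6⟩ := exists_eigenfunctions_of_chart hF.continuous.continuousAt
    hFx₀ hch hattr (contDiffAt_chart_conj hF.contMDiffAt hFx₀) hd b hb hlt hlam0 hres
  refine ⟨ψ, hlam0, h1, fun j => ?_, h3, h4, fun φ c hc hφ hsm => ?_, fun φ j hφ hsm h0 hφd => ?_⟩
  · exact contMDiff_of_eigenfunction hF hattr (hlam0 j) (h1 j) (contMDiffAt_of_contDiffAt (h2 j))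
  · exact h5 φ c hc hφ (contDiffAt_of_contMDiffAt hsm.contMDiffAt)
  · refine h6 φ j hφ (VanishesToOrder.two_of (contDiffAt_of_contMDiffAt hsm.contMDiffAt) ?_
      hφd.fderiv)
    rw [hch.symm_zero, h0]

end Manifold

theorem exists_multiIndexPairs_sum {X : Type*} {n : ℕ} {ψ : Fin n → X → ℂ} {φ : X → ℂ}
    {a : (Fin n → ℕ) →₀ ℂ}
    (h : ∀ x, φ x = ∑ i ∈ a.support, a i * multiPow (fun j => ψ j x) i) :
    ∃ k : ℕ, 1 ≤ k ∧ ∃ c : (Fin n → ℕ) → (Fin n → ℕ) → ℂ, ∀ x,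
      φ x = ∑ p ∈ multiIndexPairs n k, c p.1 p.2 * multiPow (fun j => ψ j x) p.1 *
        multiPow (fun j => (starRingEnd ℂ) (ψ j x)) p.2 := by
  classical
  -- All coefficients of genuine conjugate factors are zero; the added `1` ensures `1 ≤ k` even for
  -- constants.
  refine ⟨a.support.sup (fun i => ∑ j, i j) + 1, by omega, fun i l => if l = 0 then a i else 0,
    fun x => ?_⟩
  rw [h]
  have hinj : Function.Injective (fun i : Fin n → ℕ => (i, (0 : Fin n → ℕ))) :=
    fun i i' hii => congrArg Prod.fst hii
  refine Eq.trans ?_ (Finset.sum_subset (s₁ := a.support.map ⟨_, hinj⟩) ?_ ?_)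
  · rw [Finset.sum_map]
    refine Finset.sum_congr rfl fun i _ => ?_
    simp [multiPow]
  · intro p hp
    obtain ⟨i, hi, rfl⟩ := Finset.mem_map.1 hp
    rw [mem_multiIndexPairs]
    have := Finset.le_sup (f := fun i : Fin n → ℕ => ∑ j, i j) hi
    simp
    omega
  · rintro ⟨i, l⟩ _ hp
    by_cases hl : l = 0
    · subst hl
      have : a i = 0 := by
        by_contra hne
        exact hp (Finset.mem_map.2 ⟨i, Finsupp.mem_support_iff.2 hne, rfl⟩)
      simp [this]
    · simp [hl]

/-! ### Discrete time. -/

theorem flow_iterate {τ Q : Type*} [TopologicalSpace τ] [AddMonoidWithOne τ] [ContinuousAdd τ]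
    [TopologicalSpace Q] (Φ : Flow τ Q) (m : ℕ) (x : Q) : (Φ 1)^[m] x = Φ (m : τ) x := by
  induction m with
  | zero => simp
  | succ m ih =>
    rw [Function.iterate_succ_apply', ih, ← Φ.map_add, Nat.cast_succ, Nat.cast_add_one_comm]

theorem flow_int_eigen {Q : Type*} [TopologicalSpace Q] {Φ : Flow ℤ Q} {ψ : Q → ℂ} {c : ℂ}
    (hc : c ≠ 0) (h : ∀ x, ψ (Φ 1 x) = c * ψ x) (t : ℤ) (x : Q) : ψ (Φ t x) = c ^ t * ψ x := by
  have hnat : ∀ (m : ℕ) x, ψ (Φ (m : ℤ) x) = c ^ m * ψ x := fun m x => by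
    rw [← flow_iterate, map_iterate_of_semiconj h]
  obtain ⟨m, rfl | rfl⟩ := t.eq_nat_or_neg
  · rw [hnat, zpow_natCast]
  · have h1 := hnat m (Φ (-(m : ℤ)) x)
    rw [← Φ.map_add, add_neg_cancel, Φ.map_zero_apply] at h1
    rw [h1, zpow_neg, zpow_natCast, inv_mul_cancel_left₀ (pow_ne_zero m hc)]

section Manifold

variable {n : ℕ} {Q : Type*} [TopologicalSpace Q] [ChartedSpace (EuclideanSpace ℝ (Fin n)) Q]

theorem exists_ne_zero_of_hasFDerivAt {x₀ : Q} {ψ : Q → ℂ}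
    {w : EuclideanSpace ℝ (Fin n) →L[ℝ] ℂ} (hw : w ≠ 0)
    (h : HasFDerivAt (fun y => ψ (centeredChartSymm (n := n) x₀ y)) w 0) : ∃ x, ψ x ≠ 0 := by
  by_contra! h0
  simp only [h0] at h
  exact hw (h.unique (hasFDerivAt_const _ _))

theorem toContinuousLinearMap_basis_ne_zero
    (b : Module.Basis (Fin n) ℂ (EuclideanSpace ℝ (Fin n) →ₗ[ℝ] ℂ)) (j : Fin n) :
    LinearMap.toContinuousLinearMap (b j) ≠ 0 := fun h =>
  b.ne_zero j (by simpa using h)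

theorem finrank_dual_euclideanSpace :
    Module.finrank ℂ (EuclideanSpace ℝ (Fin n) →ₗ[ℝ] ℂ) = n := by
  rw [Module.finrank_linearMap]
  simp

theorem exists_principal_eigenfunctions_int [IsManifold (𝓡 n) ∞ Q] (x₀ : Q) (Φ : Flow ℤ Q)
    (hΦ : ∀ t : ℤ, ContMDiff (𝓡 n) (𝓡 n) ∞ (Φ t))
    (hx₀ : IsGloballyAttractingHyperbolicFixedPoint (n := n) Φ x₀)
    (hss : Module.End.IsSemisimple (derivAtFixed (n := n) (Φ 1) x₀))
    (hres : IsInftyNonresonant (complexify (derivAtFixed (n := n) (Φ 1) x₀))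
      (complexify (derivAtFixed (n := n) (Φ 1) x₀))) :
    ∃ ψ : Fin n → Q → ℂ,
      (∀ j, IsPrincipalEigenfunction (n := n) Φ {x₀} (ψ j) ∧
        ContMDiff (𝓡 n) 𝓘(ℝ, ℂ) ∞ (ψ j)) ∧
      ∀ φ : Q → ℂ, IsKoopmanEigenfunction Φ φ → ContMDiff (𝓡 n) 𝓘(ℝ, ℂ) ∞ φ →
        ∃ a : (Fin n → ℕ) →₀ ℂ, ∀ x,
          φ x = ∑ i ∈ a.support, a i * multiPow (fun j => ψ j x) i := by
  obtain ⟨b, lam, hb⟩ := exists_eigenbasis finrank_dual_euclideanSpace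
    (precomp (derivAtFixed (n := n) (Φ 1) x₀)) (precomp_eq_smul_of_isSemisimple hss)
  obtain ⟨ψ, hlam0, h1, h2, h3, h4, h5, -⟩ := exists_smooth_eigenfunctions (hΦ 1) (hx₀.fixed 1)
    (fun x => ((hx₀.attracting x).comp tendsto_natCast_atTop_atTop).congr fun m =>
      (flow_iterate Φ m x).symm)
    (fun U hU => by
      obtain ⟨V, hV, hVU⟩ := hx₀.stable U hU
      exact ⟨V, hV, fun x hx m => flow_iterate Φ m x ▸ hVU x hx m (Int.natCast_nonneg m)⟩)
    hx₀.hyperbolic hres b hb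
  -- Only integer times occur, so any logarithm of `λ_j` serves as exponent.
  refine ⟨ψ, fun j => ⟨⟨⟨?_, Complex.log (lam j), fun t x => ?_⟩, ?_, ?_, ?_⟩, h2 j⟩, ?_⟩
  · exact exists_ne_zero_of_hasFDerivAt (toContinuousLinearMap_basis_ne_zero b j) (h4 j)
  · rw [flow_int_eigen (hlam0 j) (h1 j)]
    have : Complex.log (lam j) * ((algebraMap ℤ ℝ t : ℝ) : ℂ) = t * Complex.log (lam j) := by
      simp [mul_comm]
    rw [this, Complex.exp_int_mul, Complex.exp_log (hlam0 j)]
  · exact (h2 j).of_le (by exact_mod_cast le_top)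
  · rintro x rfl
    exact h3 j
  · rintro x rfl
    exact mfderiv_ne_zero_of_hasFDerivAt (h2 j).contMDiffAt
      (toContinuousLinearMap_basis_ne_zero b j) (h4 j)
  · rintro φ ⟨-, μ, hμ⟩ hφ
    refine h5 φ (Complex.exp μ) (Complex.exp_ne_zero μ) (fun x => ?_) hφ
    simpa using hμ 1 x

/-! ### Continuous time: the linearized flow and its generator. -/

/-- The derivative at the fixed point of the time-`t` map of a flow, in the centered chart. -/
noncomputable def flowDeriv (Φ : Flow ℝ Q) (x₀ : Q) (t : ℝ) :
    EuclideanSpace ℝ (Fin n) →L[ℝ] EuclideanSpace ℝ (Fin n) :=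
  fderiv ℝ (fun y => centeredChart (n := n) x₀ (Φ t (centeredChartSymm (n := n) x₀ y))) 0

section Flow

variable {Φ : Flow ℝ Q} {x₀ : Q}

theorem contMDiff_flow
    (hΦ : ContMDiff (𝓘(ℝ, ℝ).prod (𝓡 n)) (𝓡 n) ∞ (fun p : ℝ × Q => Φ p.1 p.2)) (t : ℝ) :
    ContMDiff (𝓡 n) (𝓡 n) ∞ (Φ t) :=
  hΦ.comp (contMDiff_const.prodMk contMDiff_id)

theorem hasFDerivAt_flowDeriv [IsManifold (𝓡 n) ∞ Q]
    (hΦ : ContMDiff (𝓘(ℝ, ℝ).prod (𝓡 n)) (𝓡 n) ∞ (fun p : ℝ × Q => Φ p.1 p.2))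
    (hfix : ∀ t, Φ t x₀ = x₀) (t : ℝ) :
    HasFDerivAt (fun y => centeredChart (n := n) x₀ (Φ t (centeredChartSymm (n := n) x₀ y)))
      (flowDeriv Φ x₀ t) 0 :=
  ((contDiffAt_chart_conj (contMDiff_flow hΦ t).contMDiffAt
    (hfix t)).differentiableAt (by simp)).hasFDerivAt

theorem eventually_symm_chart_flow (hfix : ∀ t, Φ t x₀ = x₀) (s : ℝ) :
    ∀ᶠ y in 𝓝 0, centeredChartSymm (n := n) x₀ (centeredChart x₀
      (Φ s (centeredChartSymm (n := n) x₀ y))) = Φ s (centeredChartSymm (n := n) x₀ y) := by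
  have hch := isCenteredChart (n := n) x₀
  have h1 : Tendsto (Φ s) (𝓝 x₀) (𝓝 x₀) := by
    have := (Φ.continuous_toFun s).tendsto x₀
    rwa [hfix] at this
  exact (h1.comp hch.tendsto_symm).eventually hch.symm_chart

theorem flowDeriv_add [IsManifold (𝓡 n) ∞ Q]
    (hΦ : ContMDiff (𝓘(ℝ, ℝ).prod (𝓡 n)) (𝓡 n) ∞ (fun p : ℝ × Q => Φ p.1 p.2))
    (hfix : ∀ t, Φ t x₀ = x₀) (t s : ℝ) :
    flowDeriv (n := n) Φ x₀ (t + s) = flowDeriv Φ x₀ t ∘L flowDeriv Φ x₀ s := by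
  have hch := isCenteredChart (n := n) x₀
  have h1 := hasFDerivAt_flowDeriv hΦ hfix t
  have h2 : centeredChart (n := n) x₀ (Φ s (centeredChartSymm (n := n) x₀ 0)) = 0 := by
    rw [hch.symm_zero, hfix, hch.map_base]
  rw [← h2] at h1
  have h3 := h1.comp (0 : EuclideanSpace ℝ (Fin n)) (hasFDerivAt_flowDeriv hΦ hfix s)
  refine (hasFDerivAt_flowDeriv hΦ hfix (t + s)).unique (h3.congr_of_eventuallyEq ?_)
  filter_upwards [eventually_symm_chart_flow (n := n) hfix s] with y hy
  simp only [Function.comp_apply, hy, Φ.map_add]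

theorem flowDeriv_zero : flowDeriv (n := n) Φ x₀ 0 = ContinuousLinearMap.id ℝ _ := by
  refine HasFDerivAt.fderiv ((hasFDerivAt_id _).congr_of_eventuallyEq ?_)
  filter_upwards [(isCenteredChart (n := n) x₀).chart_symm] with y hy
  rw [Φ.map_zero_apply, hy, id]

/-- The linearized flow is the partial derivative, along the line `(t, 0)`, of the jointly smooth
local map `G`, so it varies differentiably with `t`. -/
theorem differentiableAt_flowDeriv [IsManifold (𝓡 n) ∞ Q]
    (hΦ : ContMDiff (𝓘(ℝ, ℝ).prod (𝓡 n)) (𝓡 n) ∞ (fun p : ℝ × Q => Φ p.1 p.2))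
    (hfix : ∀ t, Φ t x₀ = x₀) : DifferentiableAt ℝ (flowDeriv (n := n) Φ x₀) 0 := by
  have hch := isCenteredChart (n := n) x₀
  let V := EuclideanSpace ℝ (Fin n)
  let G : ℝ × V → V := fun p => centeredChart (n := n) x₀ (Φ p.1 (centeredChartSymm (n := n) x₀ p.2))
  have hG : ContDiffAt ℝ ∞ G 0 := by
    rw [← contMDiffAt_iff_contDiffAt]
    have h1 : ContMDiffAt 𝓘(ℝ, ℝ × V) 𝓘(ℝ, ℝ) ∞ (fun p : ℝ × V => p.1) 0 :=
      contDiff_fst.contMDiff.contMDiffAt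
    have h2 : ContMDiffAt 𝓘(ℝ, ℝ × V) (𝓡 n) ∞
        (fun p : ℝ × V => centeredChartSymm (n := n) x₀ p.2) 0 :=
      ContMDiffAt.comp (0 : ℝ × V) (g := centeredChartSymm (n := n) x₀)
        (contMDiffAt_centeredChartSymm x₀) contDiff_snd.contMDiff.contMDiffAt
    have h3 : ContMDiffAt 𝓘(ℝ, ℝ × V) (𝓡 n) ∞
        (fun p : ℝ × V => Φ p.1 (centeredChartSymm (n := n) x₀ p.2)) 0 :=
      ContMDiffAt.comp (0 : ℝ × V) hΦ.contMDiffAt (h1.prodMk h2)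
    have h4 : ContMDiffAt (𝓡 n) 𝓘(ℝ, V) ∞ (centeredChart (n := n) x₀)
        (Φ (0 : ℝ × V).1 (centeredChartSymm (n := n) x₀ (0 : ℝ × V).2)) := by
      rw [Prod.snd_zero, hch.symm_zero, hfix]
      exact contMDiffAt_centeredChart x₀
    exact ContMDiffAt.comp (0 : ℝ × V) (g := centeredChart (n := n) x₀) h4 h3
  have hline : Tendsto (fun t : ℝ => ((t, 0) : ℝ × V)) (𝓝 0) (𝓝 0) := by
    have : Continuous (fun t : ℝ => ((t, 0) : ℝ × V)) := by fun_prop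
    exact this.tendsto 0
  have h1 : DifferentiableAt ℝ (fun t : ℝ => (fderiv ℝ G (t, 0)) ∘L
      (ContinuousLinearMap.inr ℝ ℝ V)) 0 := by
    have h2 : DifferentiableAt ℝ (fun t : ℝ => fderiv ℝ G (t, 0)) 0 := by
      refine DifferentiableAt.comp (0 : ℝ) (g := fderiv ℝ G) ?_
        (differentiableAt_id.prodMk (differentiableAt_const _))
      exact hG.fderiv_infty.differentiableAt (by simp)
    exact h2.clm_comp (differentiableAt_const _)
  refine h1.congr_of_eventuallyEq ?_
  filter_upwards [hline.eventually hG.eventually_differentiableAt] with t ht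
  exact (HasFDerivAt.comp (0 : V) (g := G) (f := fun y => (t, y)) ht.hasFDerivAt
    (hasFDerivAt_prodMk_right t 0)).fderiv

theorem hasDerivAt_flowDeriv [IsManifold (𝓡 n) ∞ Q]
    (hΦ : ContMDiff (𝓘(ℝ, ℝ).prod (𝓡 n)) (𝓡 n) ∞ (fun p : ℝ × Q => Φ p.1 p.2))
    (hfix : ∀ t, Φ t x₀ = x₀) (w : EuclideanSpace ℝ (Fin n) →ₗ[ℝ] ℂ)
    (v : EuclideanSpace ℝ (Fin n)) (t : ℝ) :
    HasDerivAt (fun t => w (flowDeriv Φ x₀ t v))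
      (w (deriv (flowDeriv (n := n) Φ x₀) 0 (flowDeriv Φ x₀ t v))) t := by
  have h0 : HasDerivAt (flowDeriv (n := n) Φ x₀) (deriv (flowDeriv (n := n) Φ x₀) 0) (t - t) := by
    rw [sub_self]
    exact (differentiableAt_flowDeriv hΦ hfix).hasDerivAt
  have h1 : HasDerivAt (fun s => flowDeriv (n := n) Φ x₀ (s - t))
      (deriv (flowDeriv (n := n) Φ x₀) 0) t := h0.comp_sub_const t t
  have h2 := (LinearMap.toContinuousLinearMap w).hasFDerivAt.comp_hasDerivAt t
    (h1.clm_apply (hasDerivAt_const t (flowDeriv Φ x₀ t v)))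
  simp only [map_zero, add_zero] at h2
  refine h2.congr_of_eventuallyEq (Eventually.of_forall fun s => ?_)
  have := flowDeriv_add (n := n) hΦ hfix (s - t) t
  rw [sub_add_cancel] at this
  simp only [this]
  rfl

/-- Variation of constants: `exp(-μ t) w(A_t v) - t w'(v)` has zero derivative. Allowing `w'` covers
Jordan chains of length two, which is what `generator_semisimple` must exclude. -/
theorem flowDeriv_eigen [IsManifold (𝓡 n) ∞ Q]
    (hΦ : ContMDiff (𝓘(ℝ, ℝ).prod (𝓡 n)) (𝓡 n) ∞ (fun p : ℝ × Q => Φ p.1 p.2))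
    (hfix : ∀ t, Φ t x₀ = x₀) {w w' : EuclideanSpace ℝ (Fin n) →ₗ[ℝ] ℂ} {μ : ℂ}
    (hw : ∀ v, w (deriv (flowDeriv (n := n) Φ x₀) 0 v) = μ * w v + w' v)
    (hw' : ∀ t v, w' (flowDeriv Φ x₀ t v) = Complex.exp (μ * t) * w' v)
    (t : ℝ) (v : EuclideanSpace ℝ (Fin n)) :
    w (flowDeriv Φ x₀ t v) = Complex.exp (μ * t) * (w v + t * w' v) := by
  have hexp : ∀ t : ℝ, HasDerivAt (fun t : ℝ => Complex.exp (-(μ * t)))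
      (Complex.exp (-(μ * t)) * -(μ * 1)) t := fun t =>
    (((hasDerivAt_id (t : ℝ)).ofReal_comp.const_mul μ).neg).cexp
  have hd : ∀ t : ℝ, HasDerivAt (fun t : ℝ => Complex.exp (-(μ * t)) * w (flowDeriv Φ x₀ t v) -
      t * w' v) 0 t := by
    intro t
    have h1 := ((hexp t).mul (hasDerivAt_flowDeriv hΦ hfix w v t)).sub
      ((hasDerivAt_id t).ofReal_comp.mul_const (w' v))
    refine h1.congr_deriv ?_
    rw [hw, hw']
    have : Complex.exp (-(μ * t)) * Complex.exp (μ * t) = 1 := by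
      rw [← Complex.exp_add, neg_add_cancel, Complex.exp_zero]
    simp only [Complex.ofReal_one]
    linear_combination (w' v) * this
  have hconst := is_const_of_deriv_eq_zero (fun t => (hd t).differentiableAt)
    (fun t => (hd t).deriv) t 0
  simp only [Complex.ofReal_zero, mul_zero, neg_zero, Complex.exp_zero, flowDeriv_zero,
    zero_mul, sub_zero, one_mul, ContinuousLinearMap.id_apply] at hconst
  have hne : Complex.exp (-(μ * t)) * Complex.exp (μ * t) = 1 := by
    rw [← Complex.exp_add, neg_add_cancel, Complex.exp_zero]
  linear_combination Complex.exp (μ * t) * hconst - w (flowDeriv Φ x₀ t v) * hne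

theorem flowDeriv_eigen_of_eq [IsManifold (𝓡 n) ∞ Q]
    (hΦ : ContMDiff (𝓘(ℝ, ℝ).prod (𝓡 n)) (𝓡 n) ∞ (fun p : ℝ × Q => Φ p.1 p.2))
    (hfix : ∀ t, Φ t x₀ = x₀) {w : EuclideanSpace ℝ (Fin n) →ₗ[ℝ] ℂ} {μ : ℂ}
    (hw : precomp (deriv (flowDeriv (n := n) Φ x₀) 0).toLinearMap w = μ • w)
    (t : ℝ) (v : EuclideanSpace ℝ (Fin n)) :
    w (flowDeriv Φ x₀ t v) = Complex.exp (μ * t) * w v := by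
  have h1 := flowDeriv_eigen hΦ hfix (w := w) (w' := 0) (μ := μ)
    (fun v => by simpa [precomp_apply] using congrArg (fun w : EuclideanSpace ℝ (Fin n) →ₗ[ℝ] ℂ => w v) hw)
    (fun t v => by simp) t v
  simpa using h1

theorem flowDeriv_one_eq [IsManifold (𝓡 n) ∞ Q]
    (hΦ : ContMDiff (𝓘(ℝ, ℝ).prod (𝓡 n)) (𝓡 n) ∞ (fun p : ℝ × Q => Φ p.1 p.2))
    (hfix : ∀ t, Φ t x₀ = x₀) (v : EuclideanSpace ℝ (Fin n)) :
    derivAtFixed (n := n) (Φ 1) x₀ v = flowDeriv Φ x₀ 1 v := by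
  rw [(hasFDerivAt_flowDeriv hΦ hfix 1).unique
    (hasFDerivAt_chart_conj (contMDiff_flow hΦ 1).contMDiffAt (hfix 1))]
  rfl

/-- A length-two Jordan chain `w, w'` of the generator gives `w ∘ A_1 = exp(μ) (w + w')`, a
length-two chain of the time-one derivative. Semisimplicity of the latter forces `w' = 0`. -/
theorem generator_semisimple [IsManifold (𝓡 n) ∞ Q]
    (hΦ : ContMDiff (𝓘(ℝ, ℝ).prod (𝓡 n)) (𝓡 n) ∞ (fun p : ℝ × Q => Φ p.1 p.2))
    (hfix : ∀ t, Φ t x₀ = x₀)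
    (hss : Module.End.IsSemisimple (derivAtFixed (n := n) (Φ 1) x₀)) (μ : ℂ)
    (w : EuclideanSpace ℝ (Fin n) →ₗ[ℝ] ℂ)
    (hw : precomp (deriv (flowDeriv (n := n) Φ x₀) 0).toLinearMap
      (precomp (deriv (flowDeriv (n := n) Φ x₀) 0).toLinearMap w - μ • w) =
        μ • (precomp (deriv (flowDeriv (n := n) Φ x₀) 0).toLinearMap w - μ • w)) :
    precomp (deriv (flowDeriv (n := n) Φ x₀) 0).toLinearMap w = μ • w := by
  set w' := precomp (deriv (flowDeriv (n := n) Φ x₀) 0).toLinearMap w - μ • w with hw'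
  have h1 := flowDeriv_eigen_of_eq hΦ hfix hw
  have h2 := flowDeriv_eigen hΦ hfix (w := w) (w' := w') (μ := μ)
    (fun v => by simp [hw', precomp_apply]) h1
  have e1 : precomp (derivAtFixed (n := n) (Φ 1) x₀) w' = Complex.exp μ • w' := by
    ext v
    rw [precomp_apply, flowDeriv_one_eq hΦ hfix, h1]
    simp
  have e2 : precomp (derivAtFixed (n := n) (Φ 1) x₀) w - Complex.exp μ • w =
      Complex.exp μ • w' := by
    ext v
    rw [LinearMap.sub_apply, precomp_apply, flowDeriv_one_eq hΦ hfix, h2]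
    simp [mul_add]
  have e3 := precomp_eq_smul_of_isSemisimple hss (Complex.exp μ) w (by
    rw [e2, map_smul, e1])
  rw [e3, sub_self] at e2
  have e4 : w' = 0 := (smul_eq_zero.1 e2.symm).resolve_left (Complex.exp_ne_zero μ)
  exact sub_eq_zero.1 e4

end Flow

theorem exists_principal_eigenfunctions_real [IsManifold (𝓡 n) ∞ Q] (x₀ : Q) (Φ : Flow ℝ Q)
    (hΦ : ContMDiff (𝓘(ℝ, ℝ).prod (𝓡 n)) (𝓡 n) ∞ (fun p : ℝ × Q => Φ p.1 p.2))
    (hx₀ : IsGloballyAttractingHyperbolicFixedPoint (n := n) Φ x₀)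
    (hss : Module.End.IsSemisimple (derivAtFixed (n := n) (Φ 1) x₀))
    (hres : IsInftyNonresonant (complexify (derivAtFixed (n := n) (Φ 1) x₀))
      (complexify (derivAtFixed (n := n) (Φ 1) x₀))) :
    ∃ ψ : Fin n → Q → ℂ,
      (∀ j, IsPrincipalEigenfunction (n := n) Φ {x₀} (ψ j) ∧
        ContMDiff (𝓡 n) 𝓘(ℝ, ℂ) ∞ (ψ j)) ∧
      ∀ φ : Q → ℂ, IsKoopmanEigenfunction Φ φ → ContMDiff (𝓡 n) 𝓘(ℝ, ℂ) ∞ φ →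
        ∃ a : (Fin n → ℕ) →₀ ℂ, ∀ x,
          φ x = ∑ i ∈ a.support, a i * multiPow (fun j => ψ j x) i := by
  have hfix := hx₀.fixed
  have hch := isCenteredChart (n := n) x₀
  -- Distinct exponents may share the value `exp(μ_j)`, so an eigenbasis of the time-one derivative
  -- need not diagonalize the linearized flow; one of the generator does.
  obtain ⟨b, μ, hbμ⟩ := exists_eigenbasis finrank_dual_euclideanSpace
    (precomp (deriv (flowDeriv (n := n) Φ x₀) 0).toLinearMap) (generator_semisimple hΦ hfix hss)
  have heig := fun j => flowDeriv_eigen_of_eq hΦ hfix (hbμ j)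
  have hb : ∀ j, precomp (derivAtFixed (n := n) (Φ 1) x₀) (b j) = Complex.exp (μ j) • b j := by
    intro j
    ext v
    rw [precomp_apply, flowDeriv_one_eq hΦ hfix, heig]
    simp
  obtain ⟨ψ, -, h1, h2, h3, h4, h5, h6⟩ := exists_smooth_eigenfunctions (contMDiff_flow hΦ 1)
    (hfix 1)
    (fun x => ((hx₀.attracting x).comp tendsto_natCast_atTop_atTop).congr fun m =>
      (flow_iterate Φ m x).symm)
    (fun U hU => by
      obtain ⟨V, hV, hVU⟩ := hx₀.stable U hU
      exact ⟨V, hV, fun x hx m => flow_iterate Φ m x ▸ hVU x hx m (Nat.cast_nonneg m)⟩)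
    hx₀.hyperbolic hres b hb
  have hflow : ∀ j (t : ℝ) x, ψ j (Φ t x) = Complex.exp (μ j * t) * ψ j x := by
    intro j t x
    -- Since `Φᵗ` commutes with `Φ¹`, the defect is again a time-one eigenfunction with factor
    -- `exp(μ_j)`. Its differential at `x₀` is `b_j ∘ A_t - exp(μ_j t) b_j = 0`, so nonresonant
    -- uniqueness applies.
    refine sub_eq_zero.1 (h6 (fun x => ψ j (Φ t x) - Complex.exp (μ j * t) * ψ j x) j
      (fun x => ?_) ?_ ?_ ?_ x)
    · rw [← Φ.map_add, add_comm, Φ.map_add, h1, h1]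
      ring
    · have hmul : ContDiff ℝ ∞ (fun z : ℂ => Complex.exp (μ j * t) * z) :=
        contDiff_const.mul contDiff_id
      exact ((h2 j).comp (contMDiff_flow hΦ t)).sub (hmul.contMDiff.comp (h2 j))
    · simp [hfix, h3]
    · have e0 : centeredChart (n := n) x₀ (Φ t (centeredChartSymm (n := n) x₀ 0)) = 0 := by
        rw [hch.symm_zero, hfix, hch.map_base]
      have e1 := h4 j
      rw [← e0] at e1
      have e2 := (e1.comp (0 : EuclideanSpace ℝ (Fin n)) (hasFDerivAt_flowDeriv hΦ hfix t)).sub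
        ((h4 j).const_mul (Complex.exp (μ j * t)))
      have e3 : (LinearMap.toContinuousLinearMap (b j)).comp (flowDeriv (n := n) Φ x₀ t) -
          Complex.exp (μ j * t) • LinearMap.toContinuousLinearMap (b j) = 0 := by
        ext v
        simpa [sub_eq_zero] using heig j t v
      rw [e3] at e2
      refine e2.congr_of_eventuallyEq ?_
      filter_upwards [eventually_symm_chart_flow (n := n) hfix t] with y hy
      simp [hy]
  refine ⟨ψ, fun j => ⟨⟨⟨?_, μ j, hflow j⟩, ?_, ?_, ?_⟩, h2 j⟩, ?_⟩
  · exact exists_ne_zero_of_hasFDerivAt (toContinuousLinearMap_basis_ne_zero b j) (h4 j)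
  · exact (h2 j).of_le (by exact_mod_cast le_top)
  · rintro x rfl
    exact h3 j
  · rintro x rfl
    exact mfderiv_ne_zero_of_hasFDerivAt (h2 j).contMDiffAt
      (toContinuousLinearMap_basis_ne_zero b j) (h4 j)
  · rintro φ ⟨-, ν, hν⟩ hφ
    refine h5 φ (Complex.exp ν) (Complex.exp_ne_zero ν) (fun x => ?_) hφ
    simpa using hν 1 x

end Manifold

theorem mainTheorem7 {n : ℕ} {Q : Type*} [TopologicalSpace Q] [T2Space Q]
    [SecondCountableTopology Q] [ChartedSpace (EuclideanSpace ℝ (Fin n)) Q]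
    [IsManifold (𝓡 n) ∞ Q] (x₀ : Q) :
    -- discrete time
    (∀ Φ : Flow ℤ Q,
      (∀ t : ℤ, ContMDiff (𝓡 n) (𝓡 n) ∞ (Φ t)) →
      IsGloballyAttractingHyperbolicFixedPoint (n := n) Φ x₀ →
      Module.End.IsSemisimple (derivAtFixed (n := n) (Φ 1) x₀) →
      IsInftyNonresonant (complexify (derivAtFixed (n := n) (Φ 1) x₀))
        (complexify (derivAtFixed (n := n) (Φ 1) x₀)) →
      ∃ ψ : Fin n → Q → ℂ,
        (∀ j, IsPrincipalEigenfunction (n := n) Φ {x₀} (ψ j) ∧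
          ContMDiff (𝓡 n) 𝓘(ℝ, ℂ) ∞ (ψ j)) ∧
        ∀ φ : Q → ℂ, IsKoopmanEigenfunction Φ φ → ContMDiff (𝓡 n) 𝓘(ℝ, ℂ) ∞ φ →
          ∃ k : ℕ, 1 ≤ k ∧ ∃ c : (Fin n → ℕ) → (Fin n → ℕ) → ℂ, ∀ x : Q,
            φ x = ∑ p ∈ multiIndexPairs n k,
              c p.1 p.2 * multiPow (fun j => ψ j x) p.1 *
                multiPow (fun j => (starRingEnd ℂ) (ψ j x)) p.2) ∧
    -- continuous time
    (∀ Φ : Flow ℝ Q,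
      ContMDiff (𝓘(ℝ, ℝ).prod (𝓡 n)) (𝓡 n) ∞ (fun p : ℝ × Q => Φ p.1 p.2) →
      IsGloballyAttractingHyperbolicFixedPoint (n := n) Φ x₀ →
      Module.End.IsSemisimple (derivAtFixed (n := n) (Φ 1) x₀) →
      IsInftyNonresonant (complexify (derivAtFixed (n := n) (Φ 1) x₀))
        (complexify (derivAtFixed (n := n) (Φ 1) x₀)) →
      ∃ ψ : Fin n → Q → ℂ,
        (∀ j, IsPrincipalEigenfunction (n := n) Φ {x₀} (ψ j) ∧
          ContMDiff (𝓡 n) 𝓘(ℝ, ℂ) ∞ (ψ j)) ∧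
        ∀ φ : Q → ℂ, IsKoopmanEigenfunction Φ φ → ContMDiff (𝓡 n) 𝓘(ℝ, ℂ) ∞ φ →
          ∃ k : ℕ, 1 ≤ k ∧ ∃ c : (Fin n → ℕ) → (Fin n → ℕ) → ℂ, ∀ x : Q,
            φ x = ∑ p ∈ multiIndexPairs n k,
              c p.1 p.2 * multiPow (fun j => ψ j x) p.1 *
                multiPow (fun j => (starRingEnd ℂ) (ψ j x)) p.2) := by
  refine ⟨fun Φ hΦ hx₀ hss hres => ?_, fun Φ hΦ hx₀ hss hres => ?_⟩
  · obtain ⟨ψ, hψ, h⟩ := exists_principal_eigenfunctions_int x₀ Φ hΦ hx₀ hss hres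
    refine ⟨ψ, hψ, fun φ hφ hsm => ?_⟩
    obtain ⟨a, ha⟩ := h φ hφ hsm
    exact exists_multiIndexPairs_sum ha
  · obtain ⟨ψ, hψ, h⟩ := exists_principal_eigenfunctions_real x₀ Φ hΦ hx₀ hss hres
    refine ⟨ψ, hψ, fun φ hφ hsm => ?_⟩
    obtain ⟨a, ha⟩ := h φ hφ hsm
    exact exists_multiIndexPairs_sum ha
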